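/- \textbf{System.} $N$ energy-harvesting users and a base station operate over slots $i=1,2,\dots$. The normalized power gains $x(i)=(x_1(i),\dots,x_N(i))$ are nonnegative, form a (jointly) stationary process, are ergodic in each channel, and satisfy $\mathbb E[x_n(1)]<\infty$. Constants: $0<\eta<1$, $\varepsilon>1$, $N_0>0$, $P_{max},P_{avg}\ge 0$, initial battery levels $B_n(0)\ge 0$, and weights $\mu_1\ge\dots\ge\mu_N$ with $\sum_n\mu_n=1$; put $\eta'=\eta N_0/\varepsilon$. A policy consists of infinite sequences $P_{d,n}(i)\ge 0$ (desired powers), $P_0(i)$ and $a_i$. It is \emph{admissible} if $0\le P_0(i)\le P_{max}$ and $a_i\in\{0,1\}$ for all $i$, and $\limsup_{M\to\infty}\frac1M\sum_{i=1}^M a_iP_0(i)\le P_{avg}$. For powers $p=(p_1,\dots,p_N)$ let $R_n(p;x)=\log_2\Big(1+\frac{p_nx_n}{1+\sum_{k<n}p_kx_k}\Big)$. \textbf{Problem A} (battery dynamics, unlimited storage). Over all admissible policies maximize $\liminf_{M\to\infty}J^A_M$, where $J^A_M=\sum_n\mu_n\frac1M\sum_{i=1}^M(1-a_i)R_n(P'_{out}(i);x(i))$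 with $P'_{out,n}(i)=\min\{B_n(i-1)/\varepsilon,\,P_{d,n}(i)\}$ and $B_n(i)=B_n(i-1)+a_i\eta N_0P_0(i)x_n(i)-(1-a_i)\varepsilon P'_{out,n}(i)$. \textbf{Problem B} (average energy balance). Over all admissible policies that satisfy, for every $n$, $$\frac1M\sum_{i=1}^M(1-a_i)P_{d,n}(i)-\frac1M\sum_{i=1}^M\eta'a_iP_0(i)x_n(i)\to 0\qquad(M\to\infty),$$ maximize $\liminf_{M\to\infty}J^B_M$, where $J^B_M=\frac1M\sum_{i=1}^M\sum_n\mu_n(1-a_i)R_n(P_d(i);x(i))$. \textbf{Lemma.} For almost every realization of the gains, Problems A and B are equivalent in the following sense. (1) Every policy feasible for B is feasible for A, its desired powers are delivered on average, i.e. $\frac1M\sum_{i=1}^M(1-a_i)(P_{d,n}(i)-P'_{out,n}(i))\to0$ for all $n$, and $J^A_M-J^B_M\to0$. (2) For every policy feasible for A and every $\delta>0$ there is a policy feasible for B whose objective value in B is larger than or equal to the objective value of the former in A minus $\delta$. (3) The optimal values of A and B are equal, and every optimal policy of B is optimal for A. -/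

import Mathlib

open MeasureTheory Filter Topology

noncomputable section

namespace EHMac

/-- The shift on one-sided sequences. -/
def shift {E : Type*} (u : ℕ → E) : ℕ → E := fun i => u (i + 1)

/-- The law of a discrete-time process on the space of its paths. -/
def pathLaw {Ω E : Type*} [MeasurableSpace Ω] [MeasurableSpace E] (P : Measure Ω)
    (X : ℕ → Ω → E) : Measure (ℕ → E) :=
  P.map (fun ω i => X i ω)

/-- A process is stationary if its path law is invariant under the shift. -/
def IsStationaryProcess {Ω E : Type*} [MeasurableSpace Ω] [MeasurableSpace E] (P : Measure Ω)
    (X : ℕ → Ω → E) : Prop :=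
  MeasurePreserving shift (pathLaw P X) (pathLaw P X)

/-- A process is stationary and ergodic if the shift is ergodic for its path law. -/
def IsErgodicProcess {Ω E : Type*} [MeasurableSpace Ω] [MeasurableSpace E] (P : Measure Ω)
    (X : ℕ → Ω → E) : Prop :=
  Ergodic shift (pathLaw P X)

/-- The average over the first `M` slots. Slots are numbered `0, 1, 2, …`. -/
def timeAvg (f : ℕ → ℝ) (M : ℕ) : ℝ := (1 / (M : ℝ)) * ∑ i ∈ Finset.range M, f i

/-- The constants of the system with `N` energy-harvesting users. -/
structure System (N : ℕ) where
  /-- power conversion efficiency -/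
  η : ℝ
  η_pos : 0 < η
  η_lt_one : η < 1
  /-- power amplifier coefficient: sending power `p` drains `ε * p` from the battery -/
  ε : ℝ
  one_lt_ε : 1 < ε
  /-- noise power -/
  N₀ : ℝ
  N₀_pos : 0 < N₀
  /-- peak power of the base station -/
  Pmax : ℝ
  Pmax_nonneg : 0 ≤ Pmax
  /-- average power of the base station -/
  Pavg : ℝ
  Pavg_nonneg : 0 ≤ Pavg
  /-- initial battery levels -/
  B₀ : Fin N → ℝ
  B₀_nonneg : ∀ n, 0 ≤ B₀ n
  /-- rate weights, in decreasing order -/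
  μ : Fin N → ℝ
  μ_antitone : Antitone μ
  μ_sum : ∑ n, μ n = 1

/-- The optimization variables, over infinitely many slots. -/
structure Policy (N : ℕ) where
  /-- desired transmit power of user `n` in slot `i` -/
  Pd : Fin N → ℕ → ℝ
  /-- output power of the base station in slot `i` -/
  P0 : ℕ → ℝ
  /-- `1` if slot `i` is a downlink slot, `0` if it is an uplink slot -/
  a : ℕ → ℝ

variable {N : ℕ}

/-- The effective conversion coefficient `η' = η N₀ / ε`. -/
def System.η' (S : System N) : ℝ := S.η * S.N₀ / S.ε

/-- The battery level of user `n` at the beginning of slot `i` (storage is unlimited), when the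
normalized channel gains are `x i n`. -/
def battery (S : System N) (x : ℕ → Fin N → ℝ) (π : Policy N) (n : Fin N) : ℕ → ℝ
  | 0 => S.B₀ n
  | i + 1 => battery S x π n i + π.a i * S.η * S.N₀ * π.P0 i * x i n
      - (1 - π.a i) * S.ε * min (battery S x π n i / S.ε) (π.Pd n i)

/-- The power that user `n` can actually deliver in slot `i`. -/
def delivered (S : System N) (x : ℕ → Fin N → ℝ) (π : Policy N) (n : Fin N) (i : ℕ) : ℝ :=
  min (battery S x π n i / S.ε) (π.Pd n i)

/-- The rate (bits per symbol) of user `n` under successive interference cancellation, for transmit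
powers `p` and gains `g`: only the users `k < n` interfere with user `n`. -/
def sicRate (p g : Fin N → ℝ) (n : Fin N) : ℝ :=
  Real.logb 2 (1 + p n * g n / (1 + ∑ k ∈ Finset.univ.filter (fun k => k < n), p k * g k))

/-- The constraints that both problems share: average and peak power of the base station,
Boolean scheduling variables, and nonnegative desired powers. -/
structure BasicConstraints (S : System N) (π : Policy N) : Prop where
  avg_power : limsup (fun M => ((timeAvg (fun i => π.a i * π.P0 i) M : ℝ) : EReal)) atTop
    ≤ ((S.Pavg : ℝ) : EReal)
  peak_power : ∀ i, 0 ≤ π.P0 i ∧ π.P0 i ≤ S.Pmax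
  boolean : ∀ i, π.a i = 0 ∨ π.a i = 1
  desired_nonneg : ∀ n i, 0 ≤ π.Pd n i

/-- The average energy balance: each user's average desired uplink power equals, in the limit of
infinitely many slots, its average usable harvested power. -/
def EnergyBalance (S : System N) (x : ℕ → Fin N → ℝ) (π : Policy N) : Prop :=
  ∀ n, Tendsto (fun M => timeAvg (fun i => (1 - π.a i) * π.Pd n i) M
    - timeAvg (fun i => S.η' * π.a i * π.P0 i * x i n) M) atTop (𝓝 0)

/-- An optimization problem over policies: a feasible set, and the weighted sum rate achieved over
the first `M` slots. The objective is the long-run (`M → ∞`) guaranteed average. -/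
structure Problem (N : ℕ) where
  Feasible : Policy N → Prop
  rate : Policy N → ℕ → ℝ

/-- The objective: the limit inferior, as `M → ∞`, of the weighted sum rate over `M` slots. -/
def Problem.objective (Q : Problem N) (π : Policy N) : EReal :=
  liminf (fun M => ((Q.rate π M : ℝ) : EReal)) atTop

/-- The optimal value. -/
def Problem.value (Q : Problem N) : EReal :=
  ⨆ (π : Policy N) (_ : Q.Feasible π), Q.objective π

/-- A policy is optimal if it is feasible and attains the optimal value. -/
def Problem.IsOptimal (Q : Problem N) (π : Policy N) : Prop :=
  Q.Feasible π ∧ Q.objective π = Q.value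

/-- The problem with battery dynamics: the users transmit with the delivered powers. -/
def batteryProblem (S : System N) (x : ℕ → Fin N → ℝ) : Problem N where
  Feasible := fun π => BasicConstraints S π
  rate := fun π M => ∑ n, S.μ n * timeAvg (fun i =>
    (1 - π.a i) * sicRate (fun k => delivered S x π k i) (x i) n) M

/-- The problem with the average energy balance: the users transmit with the desired powers. -/
def balanceProblem (S : System N) (x : ℕ → Fin N → ℝ) : Problem N where
  Feasible := fun π => BasicConstraints S π ∧ EnergyBalance S x π
  rate := fun π M => timeAvg (fun i => ∑ n, S.μ n *
    ((1 - π.a i) * sicRate (fun k => π.Pd k i) (x i) n)) M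

end EHMac

end

/-! The proof is pathwise: for almost every realization the gains have uniformly small tail
averages, and every cell of every quantizer has a limiting frequency (`ae_regularGains`). Both facts
come from the maximal ergodic theorem. The rest is deterministic.

Every rate comparison rests on one modulus of continuity. The weighted sum rate is 1/2-Hölder in the
received powers, and a received-power error is bounded by a power error times a gain. By
Cauchy–Schwarz, the average rate error is at most a constant times the sum over users of the square
root of (average power error) × (average gain) (`sum_abs_sumRate_sub_le`).

From B to A: the shortfall of a user grows only in slots that empty its battery. At such a moment
all the energy harvested so far has been spent, so the accumulated shortfall is at most the
accumulated imbalance, which is sublinear (`sum_shortfall_le`). The modulus turns this into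
agreement of the rates (`tendsto_rate_sub`).

From A to B, the delivered powers need not be balanced, because the stored energy may swing on the
scale of the elapsed time. Instead, one long window is taken on which the policy performs well and
its constraints nearly hold, and it is imitated forever: a slot whose quantized gains lie in a given
cell copies a window slot of the same cell, cycling through these (`exists_selection`). The
resulting averages converge to nearly uniform reweightings of the window averages. Slightly scaling
down the powers restores the constraints, and the nonnegative energy surplus that remains is spent
in the square slots, which have density zero, so that the balance holds in the limit
(`TailSmall.exists_dump`, `Quantizer.exists_feasible`). The total loss is of order √τ for accuracy τ
(`exists_balance_policy`).

Equality of values and transfer of optimal policies follow from the two directions. -/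

noncomputable section

namespace EHMac

/-! ### Maximal ergodic theorem and its consequences -/

section Ergodic

variable {α : Type*} {T : α → α}

/-- The running maximum of `0` and the first `n` Birkhoff sums. -/
def birkhoffMax (T : α → α) (f : α → ℝ) : ℕ → α → ℝ
  | 0 => fun _ => 0
  | n + 1 => fun x => max 0 (f x + birkhoffMax T f n (T x))

lemma birkhoffMax_nonneg (f : α → ℝ) (n : ℕ) (x : α) : 0 ≤ birkhoffMax T f n x := by
  cases n with
  | zero => exact le_rfl
  | succ n => exact le_max_left _ _

lemma birkhoffMax_le_succ (f : α → ℝ) (n : ℕ) (x : α) :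
    birkhoffMax T f n x ≤ birkhoffMax T f (n + 1) x := by
  induction n generalizing x with
  | zero => exact birkhoffMax_nonneg f 1 x
  | succ n ih => exact max_le_max le_rfl (add_le_add le_rfl (ih (T x)))

lemma birkhoffSum_le_birkhoffMax (f : α → ℝ) (n : ℕ) (x : α) :
    birkhoffSum T f n x ≤ birkhoffMax T f n x := by
  induction n generalizing x with
  | zero => simp [birkhoffMax]
  | succ n ih =>
    rw [birkhoffSum_succ']
    exact le_trans (add_le_add le_rfl (ih (T x))) (le_max_right _ _)

lemma exists_birkhoffSum_eq_birkhoffMax (f : α → ℝ) (n : ℕ) (x : α) :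
    ∃ k, birkhoffMax T f n x = birkhoffSum T f k x := by
  induction n generalizing x with
  | zero => exact ⟨0, by simp [birkhoffMax]⟩
  | succ n ih =>
    obtain ⟨k, hk⟩ := ih (T x)
    rcases max_choice 0 (f x + birkhoffMax T f n (T x)) with h | h
    · exact ⟨0, by rw [birkhoffSum_zero]; exact h⟩
    · refine ⟨k + 1, ?_⟩
      rw [birkhoffSum_succ', ← hk]; exact h

/-- The points whose Birkhoff sums are unbounded above. -/
def sumsUnbounded (T : α → α) (f : α → ℝ) : Set α :=
  {x | ∀ C : ℕ, ∃ n, (C : ℝ) < birkhoffSum T f n x}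

/-- Passing from `x` to `T x` drops the single term `f x`, which does not affect unboundedness. The
invariance is exact, so Birkhoff sums can be localized to this set. -/
lemma sumsUnbounded_invariant (f : α → ℝ) (x : α) :
    T x ∈ sumsUnbounded T f ↔ x ∈ sumsUnbounded T f := by
  constructor
  · intro h C
    obtain ⟨D, hD⟩ := exists_nat_gt (C - f x)
    obtain ⟨n, hn⟩ := h D
    exact ⟨n + 1, by rw [birkhoffSum_succ']; linarith⟩
  · intro h C
    obtain ⟨D, hD⟩ := exists_nat_gt (C + f x)
    obtain ⟨n, hn⟩ := h D
    cases n with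
    | zero => 
      rw [birkhoffSum_zero] at hn
      exact absurd hn (not_lt.2 (Nat.cast_nonneg D))
    | succ n =>
      rw [birkhoffSum_succ'] at hn
      exact ⟨n, by linarith⟩

variable [MeasurableSpace α] {μ : Measure α}

lemma measurable_birkhoffSum (hT : Measurable T) {f : α → ℝ} (hf : Measurable f) (n : ℕ) :
    Measurable (birkhoffSum T f n) := by
  unfold birkhoffSum
  exact Finset.measurable_sum _ fun i _ => hf.comp (hT.iterate i)

lemma measurable_birkhoffMax (hT : Measurable T) {f : α → ℝ} (hf : Measurable f) (n : ℕ) :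
    Measurable (birkhoffMax T f n) := by
  induction n with
  | zero => exact measurable_const
  | succ n ih => exact measurable_const.max (hf.add (ih.comp hT))

lemma integrable_birkhoffMax (hT : MeasurePreserving T μ μ) {f : α → ℝ} (hi : Integrable f μ)
    (n : ℕ) : Integrable (birkhoffMax T f n) μ := by
  induction n with
  | zero => exact integrable_zero _ _ _
  | succ n ih => exact (integrable_zero _ _ _).sup (hi.add (hT.integrable_comp_of_integrable ih))

/-- The maximal ergodic theorem. -/
theorem setIntegral_nonneg_of_exists_birkhoffSum_pos (hT : MeasurePreserving T μ μ) {f : α → ℝ}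
    (hf : Measurable f) (hi : Integrable f μ) :
    0 ≤ ∫ x in {x | ∃ k, 0 < birkhoffSum T f k x}, f x ∂μ := by
  have hm := measurable_birkhoffMax hT.measurable hf
  have hint := fun n => integrable_birkhoffMax hT hi n
  have hset : {x | ∃ k, 0 < birkhoffSum T f k x} = ⋃ n, {x | 0 < birkhoffMax T f n x} := by
    ext x
    simp only [Set.mem_ofPred_eq, Set.mem_iUnion]
    constructor
    · rintro ⟨k, hk⟩
      exact ⟨k, hk.trans_le (birkhoffSum_le_birkhoffMax f k x)⟩
    · rintro ⟨n, hn⟩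
      obtain ⟨k, hk⟩ := exists_birkhoffSum_eq_birkhoffMax (T := T) f n x
      exact ⟨k, hk ▸ hn⟩
  have hpos : ∀ n, MeasurableSet {x | 0 < birkhoffMax T f n x} := fun n =>
    measurableSet_lt measurable_const (hm n)
  have hmono : Monotone fun n => {x | 0 < birkhoffMax T f n x} :=
    monotone_nat_of_le_succ fun n x hx => lt_of_lt_of_le hx (birkhoffMax_le_succ f n x)
  have hlim := tendsto_setIntegral_of_monotone hpos hmono hi.integrableOn
  rw [hset]
  refine ge_of_tendsto' hlim fun n => ?_
  set A := {x | 0 < birkhoffMax T f n x}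
  have hcomp : Integrable (fun x => birkhoffMax T f n (T x)) μ :=
    hT.integrable_comp_of_integrable (hint n)
  -- On `A` the maximum in the recursion is not `0`, and replacing the maximum at `T x` by the next
  -- one only increases it, so `f` dominates the maximum minus its composition with `T`. By
  -- invariance of `μ`, this difference has nonnegative integral over `A`: its first term vanishes
  -- off `A`, its second is nonnegative there.
  have h1 : ∫ x in A, (birkhoffMax T f n x - birkhoffMax T f n (T x)) ∂μ ≤ ∫ x in A, f x ∂μ := by
    refine setIntegral_mono_on ((hint n).sub hcomp).integrableOn hi.integrableOn (hpos n) ?_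
    intro x hx
    cases n with
    | zero => exact absurd (show (0 : ℝ) < 0 from hx) (lt_irrefl _)
    | succ n =>
      have hx' : 0 < birkhoffMax T f (n + 1) x := hx
      have : birkhoffMax T f (n + 1) x = f x + birkhoffMax T f n (T x) := by
        rcases max_choice 0 (f x + birkhoffMax T f n (T x)) with h | h
        · exact absurd (show birkhoffMax T f (n + 1) x = 0 from h) hx'.ne'
        · exact h
      have := birkhoffMax_le_succ (T := T) f n (T x)
      linarith
  have h2 : ∫ x in A, birkhoffMax T f n x ∂μ = ∫ x, birkhoffMax T f n x ∂μ := by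
    refine setIntegral_eq_integral_of_forall_compl_eq_zero fun x hx => ?_
    exact le_antisymm (not_lt.1 hx) (birkhoffMax_nonneg f n x)
  have h3 : ∫ x in A, birkhoffMax T f n (T x) ∂μ ≤ ∫ x, birkhoffMax T f n (T x) ∂μ :=
    setIntegral_le_integral hcomp (ae_of_all _ fun x => birkhoffMax_nonneg f n (T x))
  have h4 : ∫ x, birkhoffMax T f n (T x) ∂μ = ∫ x, birkhoffMax T f n x ∂μ := by
    have h := integral_map (μ := μ) hT.measurable.aemeasurable (f := birkhoffMax T f n)
      (by rw [hT.map_eq]; exact (hint n).aestronglyMeasurable)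
    rw [hT.map_eq] at h
    exact h.symm
  rw [integral_sub (hint n).integrableOn hcomp.integrableOn] at h1
  linarith

/-- The maximal theorem is applied to `A.indicator f`. By invariance its Birkhoff sums are those of
`f` on `A` and zero elsewhere, so the set of points with a positive sum is exactly `A`. -/
lemma setIntegral_nonneg_of_invariant (hT : MeasurePreserving T μ μ) {f : α → ℝ}
    (hf : Measurable f) (hi : Integrable f μ) {A : Set α} (hA : MeasurableSet A)
    (hinv : ∀ x, T x ∈ A ↔ x ∈ A) (hpos : ∀ x ∈ A, ∃ k, 0 < birkhoffSum T f k x) :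
    0 ≤ ∫ x in A, f x ∂μ := by
  have hsum : ∀ k x, birkhoffSum T (A.indicator f) k x = A.indicator (birkhoffSum T f k) x := by
    intro k
    induction k with
    | zero => intro x; by_cases hx : x ∈ A <;> simp [hx]
    | succ k ih =>
      intro x
      rw [birkhoffSum_succ', ih]
      by_cases hx : x ∈ A
      · have hTx := (hinv x).2 hx
        simp [hx, hTx, birkhoffSum_succ']
      · have hTx : T x ∉ A := fun h => hx ((hinv x).1 h)
        simp [hx, hTx]
  have h := setIntegral_nonneg_of_exists_birkhoffSum_pos hT (hf.indicator hA) (hi.indicator hA)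
  have hset : {x | ∃ k, 0 < birkhoffSum T (A.indicator f) k x} = A := by
    ext x
    simp only [Set.mem_ofPred_eq, hsum]
    by_cases hx : x ∈ A
    · simpa [hx] using hpos x hx
    · simp [hx]
  rw [hset, setIntegral_indicator hA, Set.inter_self] at h
  exact h

lemma measurableSet_sumsUnbounded (hT : Measurable T) {f : α → ℝ} (hf : Measurable f) :
    MeasurableSet (sumsUnbounded T f) := by
  have : sumsUnbounded T f = ⋂ C : ℕ, ⋃ n, {x | (C : ℝ) < birkhoffSum T f n x} := by
    ext x; simp [sumsUnbounded]
  rw [this]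
  exact MeasurableSet.iInter fun C => MeasurableSet.iUnion fun n =>
    measurableSet_lt measurable_const (measurable_birkhoffSum hT hf n)

/-- Both `f - b` and `a - f` have nonnegative integral over the invariant intersection, yet they add
up to the negative constant `a - b`. -/
lemma measure_oscillation_eq_zero [IsProbabilityMeasure μ] (hT : MeasurePreserving T μ μ)
    {f : α → ℝ} (hf : Measurable f) (hi : Integrable f μ) {a b : ℝ} (hab : a < b) :
    μ (sumsUnbounded T (fun x => f x - b) ∩ sumsUnbounded T (fun x => a - f x)) = 0 := by
  set A := sumsUnbounded T (fun x => f x - b) ∩ sumsUnbounded T (fun x => a - f x) with hAdef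
  have hA : MeasurableSet A := (measurableSet_sumsUnbounded hT.measurable (hf.sub_const b)).inter
    (measurableSet_sumsUnbounded hT.measurable (measurable_const.sub hf))
  have hinv : ∀ x, T x ∈ A ↔ x ∈ A := fun x => by
    simp only [hAdef, Set.mem_inter_iff, sumsUnbounded_invariant]
  have h1 := setIntegral_nonneg_of_invariant hT (hf.sub_const b)
    (hi.sub (integrable_const b)) hA hinv (fun x hx => by simpa using hx.1 0)
  have h2 := setIntegral_nonneg_of_invariant (f := fun x => a - f x) hT (measurable_const.sub hf)
    ((integrable_const a).sub hi) hA hinv (fun x hx => by simpa using hx.2 0)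
  have h3 : ∫ x in A, ((f x - b) + (a - f x)) ∂μ
      = (∫ x in A, (f x - b) ∂μ) + ∫ x in A, (a - f x) ∂μ :=
    integral_add (hi.sub (integrable_const b)).integrableOn
      ((integrable_const a).sub hi).integrableOn
  have h4 : ∫ x in A, ((f x - b) + (a - f x)) ∂μ = μ.real A * (a - b) := by
    have : (fun x => (f x - b) + (a - f x)) = fun _ => a - b := by ext x; ring
    rw [this, setIntegral_const, smul_eq_mul]
  have h5 : 0 ≤ μ.real A := measureReal_nonneg
  have h6 : μ.real A = 0 := by nlinarith
  exact (measureReal_eq_zero_iff).1 h6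

/-- The weak-type maximal inequality. -/
lemma mul_measure_exists_birkhoffSum_gt_le [IsProbabilityMeasure μ] (hT : MeasurePreserving T μ μ)
    {f : α → ℝ} (hf : Measurable f) (hi : Integrable f μ) (h0 : ∀ x, 0 ≤ f x) (c : ℝ) :
    c * μ.real {x | ∃ k : ℕ, c * k < birkhoffSum T f k x} ≤ ∫ x, f x ∂μ := by
  have hsum : ∀ k x, birkhoffSum T (fun x => f x - c) k x = birkhoffSum T f k x - c * k := by
    intro k x
    simp [birkhoffSum, Finset.sum_sub_distrib, mul_comm]
  have h := setIntegral_nonneg_of_exists_birkhoffSum_pos hT (hf.sub_const c)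
    (hi.sub (integrable_const c))
  simp only [hsum, sub_pos] at h
  rw [integral_sub hi.integrableOn (integrable_const c).integrableOn, setIntegral_const,
    smul_eq_mul] at h
  have h' : ∫ x in {x | ∃ k : ℕ, c * k < birkhoffSum T f k x}, f x ∂μ ≤ ∫ x, f x ∂μ :=
    setIntegral_le_integral hi (ae_of_all _ h0)
  linarith

end Ergodic

/-! ### Almost sure regularity of the gains -/

variable {N : ℕ}

/-- The cell of a gain vector under the quantizer with step `1 / m` and range `m`. -/
def cell (m : ℕ) (e : Fin N → ℝ) : Fin N → ℕ := fun n => min ⌊e n * m⌋₊ (m * m)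

lemma measurable_cell (m : ℕ) : Measurable (cell m : (Fin N → ℝ) → Fin N → ℕ) :=
  measurable_pi_iff.2 fun n =>
    (Nat.measurable_floor.comp ((measurable_pi_apply n).mul_const _)).min measurable_const

/-- Almost sure properties of the gains: nonnegativity, uniformly small averages of the tails, and
convergence of the frequencies of all cells of the quantizers with step `1 / m` and range `m`. -/
structure RegularGains (x : ℕ → Fin N → ℝ) : Prop where
  nonneg : ∀ i n, 0 ≤ x i n
  tail : ∀ n, ∀ δ : ℝ, 0 < δ → ∃ m₀ : ℕ, ∀ m : ℕ, m₀ ≤ m → ∀ M,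
    timeAvg (fun i => max 0 (x i n - m)) M ≤ δ
  freq : ∀ (m : ℕ) (c : Fin N → ℕ), ∃ f : ℝ, Tendsto (fun M => timeAvg (fun i =>
    if cell m (x i) = c then 1 else 0) M) atTop (𝓝 f)

lemma birkhoffSum_shift {E : Type*} (φ : E → ℝ) (k : ℕ) (u : ℕ → E) :
    birkhoffSum shift (fun u => φ (u 0)) k u = ∑ i ∈ Finset.range k, φ (u i) := by
  induction k generalizing u with
  | zero => simp
  | succ k ih => rw [birkhoffSum_succ', ih, Finset.sum_range_succ', add_comm]; rfl

/-- The weak-type inequality bounds the probability that some average of the tail beyond `m` exceeds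
`δ` by the mean tail divided by `δ`, which tends to zero by dominated convergence. Hence almost
every path avoids one of these events. This makes the bound uniform in `M`, and larger `m` only
shrink the tail. -/
lemma ae_tail_small {Q : Measure (ℕ → Fin N → ℝ)} [IsProbabilityMeasure Q]
    (hT : MeasurePreserving shift Q Q) (n : Fin N) (hi : Integrable (fun u => u 0 n) Q)
    {δ : ℝ} (hδ : 0 < δ) : ∀ᵐ u ∂Q, ∃ m₀ : ℕ, ∀ m : ℕ, m₀ ≤ m → ∀ M,
      timeAvg (fun i => max 0 (u i n - m)) M ≤ δ := by
  let φ : ℕ → (Fin N → ℝ) → ℝ := fun m e => max 0 (e n - m)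
  have hφ : ∀ m, Measurable fun u : ℕ → Fin N → ℝ => φ m (u 0) := fun m => by
    have : Measurable fun u : ℕ → Fin N → ℝ => u 0 n :=
      (measurable_pi_apply n).comp (measurable_pi_apply 0)
    exact measurable_const.max (this.sub_const _)
  have hbd : ∀ m (u : ℕ → Fin N → ℝ), ‖φ m (u 0)‖ ≤ ‖u 0 n‖ := fun m u => by
    have hm : (0 : ℝ) ≤ m := m.cast_nonneg
    rw [Real.norm_of_nonneg (le_max_left _ _)]
    exact max_le (norm_nonneg _) (by linarith [Real.le_norm_self (u 0 n)])
  have hφi : ∀ m, Integrable (fun u : ℕ → Fin N → ℝ => φ m (u 0)) Q := fun m =>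
    hi.mono (hφ m).aestronglyMeasurable (ae_of_all _ (hbd m))
  have hlim : Tendsto (fun m => ∫ u, φ m (u 0) ∂Q) atTop (𝓝 0) := by
    have h := tendsto_integral_of_dominated_convergence (μ := Q) (f := fun _ => (0 : ℝ))
      (F := fun m (u : ℕ → Fin N → ℝ) => φ m (u 0)) (fun u => ‖u 0 n‖)
      (fun m => (hφ m).aestronglyMeasurable) hi.norm (fun m => ae_of_all _ (hbd m))
      (ae_of_all _ fun u => by
        obtain ⟨k, hk⟩ := exists_nat_ge (u 0 n)
        refine tendsto_const_nhds.congr' ?_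
        filter_upwards [eventually_ge_atTop k] with m hm
        have : (k : ℝ) ≤ m := by exact_mod_cast hm
        exact (max_eq_left (by linarith)).symm)
    simpa using h
  let A : ℕ → Set (ℕ → Fin N → ℝ) := fun m =>
    {u | ∃ k : ℕ, δ * k < birkhoffSum shift (fun u => φ m (u 0)) k u}
  have hA : ∀ m, Q.real (A m) ≤ (∫ u, φ m (u 0) ∂Q) / δ := fun m => by
    rw [le_div_iff₀ hδ, mul_comm]
    exact mul_measure_exists_birkhoffSum_gt_le hT (hφ m) (hφi m) (fun u => le_max_left _ _) δ
  have hnull : Q.real (⋂ m, A m) = 0 := by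
    refine le_antisymm ?_ measureReal_nonneg
    refine ge_of_tendsto' (by simpa using hlim.div_const δ) fun m => ?_
    exact (measureReal_mono (Set.iInter_subset _ m)).trans (hA m)
  have hae : ∀ᵐ u ∂Q, u ∉ ⋂ m, A m :=
    measure_eq_zero_iff_ae_notMem.1 ((measureReal_eq_zero_iff).1 hnull)
  filter_upwards [hae] with u hu
  simp only [Set.mem_iInter, not_forall] at hu
  obtain ⟨m₀, hm₀⟩ := hu
  refine ⟨m₀, fun m hm M => ?_⟩
  have h1 : ∑ i ∈ Finset.range M, φ m₀ (u i) ≤ δ * M := by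
    rw [← birkhoffSum_shift]
    exact not_lt.1 fun h => hm₀ ⟨M, h⟩
  have h2 : ∑ i ∈ Finset.range M, max 0 (u i n - m) ≤ ∑ i ∈ Finset.range M, φ m₀ (u i) := by
    refine Finset.sum_le_sum fun i _ => max_le_max le_rfl ?_
    have : (m₀ : ℝ) ≤ m := by exact_mod_cast hm
    linarith
  unfold timeAvg
  rcases Nat.eq_zero_or_pos M with rfl | hM
  · simpa using hδ.le
  · have : (0 : ℝ) < M := by exact_mod_cast hM
    rw [one_div, inv_mul_le_iff₀ this]
    linarith

/-- Bounded averages that do not converge cross some rational interval infinitely often, which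
forces the oscillation sets to contain the path. Only existence of the limit is needed, so it is not
identified. -/
lemma ae_exists_tendsto_timeAvg {E : Type*} [MeasurableSpace E] {Q : Measure (ℕ → E)}
    [IsProbabilityMeasure Q] (hT : MeasurePreserving shift Q Q) {φ : E → ℝ} (hφ : Measurable φ)
    (h0 : ∀ e, 0 ≤ φ e) (h1 : ∀ e, φ e ≤ 1) :
    ∀ᵐ u ∂Q, ∃ f : ℝ, Tendsto (fun M => timeAvg (fun i => φ (u i)) M) atTop (𝓝 f) := by
  have hm : Measurable fun u : ℕ → E => φ (u 0) := hφ.comp (measurable_pi_apply 0)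
  have hi : Integrable (fun u : ℕ → E => φ (u 0)) Q :=
    Integrable.of_bound hm.aestronglyMeasurable 1 (ae_of_all _ fun u => by
      rw [Real.norm_of_nonneg (h0 _)]; exact h1 _)
  have hosc : ∀ᵐ u ∂Q, ∀ a b : ℚ, (a : ℝ) < b →
      u ∉ sumsUnbounded shift (fun u : ℕ → E => φ (u 0) - b) ∩
        sumsUnbounded shift (fun u : ℕ → E => a - φ (u 0)) := by
    rw [ae_all_iff]; intro a
    rw [ae_all_iff]; intro b
    by_cases hab : (a : ℝ) < b
    · have := measure_eq_zero_iff_ae_notMem.1 (measure_oscillation_eq_zero hT hm hi hab)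
      filter_upwards [this] with u hu _ using hu
    · exact ae_of_all _ fun u h => absurd h hab
  filter_upwards [hosc] with u hu
  have hunb : ∀ (ψ : E → ℝ) (d : ℝ), 0 < d →
      (∃ᶠ M in atTop, d < timeAvg (fun i => ψ (u i)) M) →
      u ∈ sumsUnbounded shift (fun u : ℕ → E => ψ (u 0)) := by
    intro ψ d hd hfr C
    obtain ⟨K, hK⟩ := exists_nat_gt (C / d)
    obtain ⟨M, hM1, hM2⟩ := (hfr.and_eventually (eventually_ge_atTop (K + 1))).exists
    refine ⟨M, ?_⟩
    rw [birkhoffSum_shift]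
    have hM0 : (0 : ℝ) < M := by exact_mod_cast (Nat.succ_pos K).trans_le hM2
    have hKM : (K : ℝ) < M := by exact_mod_cast hM2
    unfold timeAvg at hM1
    rw [one_div, lt_inv_mul_iff₀ hM0] at hM1
    rw [div_lt_iff₀ hd] at hK
    nlinarith
  have hsub : ∀ (s : ℝ) (b : ℝ) (M : ℕ), 0 < M →
      timeAvg (fun i => s * (φ (u i) - b)) M = s * (timeAvg (fun i => φ (u i)) M - b) := by
    intro s b M hM
    have : (M : ℝ) ≠ 0 := by exact_mod_cast hM.ne'
    unfold timeAvg
    rw [← Finset.mul_sum, Finset.sum_sub_distrib]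
    simp only [Finset.sum_const, Finset.card_range, nsmul_eq_mul]
    field_simp
  have hbd : ∀ M, 0 ≤ timeAvg (fun i => φ (u i)) M ∧ timeAvg (fun i => φ (u i)) M ≤ 1 := by
    intro M
    unfold timeAvg
    refine ⟨mul_nonneg (by positivity) (Finset.sum_nonneg fun i _ => h0 _), ?_⟩
    rcases Nat.eq_zero_or_pos M with rfl | hM
    · simp
    · have : (0 : ℝ) < M := by exact_mod_cast hM
      rw [one_div, inv_mul_le_iff₀ this]
      calc _ ≤ ∑ i ∈ Finset.range M, (1 : ℝ) := Finset.sum_le_sum fun i _ => h1 _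
        _ = M * 1 := by simp
  refine tendsto_of_no_upcrossings Rat.denseRange_cast ?_ ?_ ?_
  · rintro _ ⟨a, rfl⟩ _ ⟨b, rfl⟩ hab ⟨hf1, hf2⟩
    -- Rational levels strictly inside the interval leave a fixed margin, so the centred sums exceed
    -- a positive multiple of `M` infinitely often.
    obtain ⟨a', ha1, ha2⟩ := exists_rat_btwn hab
    obtain ⟨b', hb1, hb2⟩ := exists_rat_btwn ha2
    refine hu a' b' hb1 ⟨?_, ?_⟩
    · refine hunb (fun e => φ e - b') (b - b') (by linarith) ?_
      refine (hf2.and_eventually (eventually_gt_atTop 0)).mono fun M hM => ?_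
      have := hsub 1 b' M hM.2
      simp only [one_mul] at this
      rw [this]; linarith [hM.1]
    · refine hunb (fun e => a' - φ e) (a' - a) (by linarith) ?_
      refine (hf1.and_eventually (eventually_gt_atTop 0)).mono fun M hM => ?_
      have := hsub (-1) a' M hM.2
      simp only [neg_mul, one_mul, neg_sub] at this
      rw [this]; linarith [hM.1]
  · exact isBoundedUnder_of ⟨1, fun M => (hbd M).2⟩
  · exact isBoundedUnder_of ⟨0, fun M => (hbd M).1⟩

/-- Only countably many conditions are involved, once the tolerances are restricted to `1 / (k +
1)`; each holds for the path law and is pulled back to `Ω`. -/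
theorem ae_regularGains {Ω : Type*} [MeasurableSpace Ω] (P : Measure Ω) [IsProbabilityMeasure P]
    (x : ℕ → Ω → Fin N → ℝ) (hx_meas : ∀ i, Measurable (x i))
    (hx_nonneg : ∀ᵐ ω ∂P, ∀ i n, 0 ≤ x i ω n)
    (hx_int : ∀ n, Integrable (fun ω => x 0 ω n) P)
    (hx_stat : IsStationaryProcess P x) : ∀ᵐ ω ∂P, RegularGains (fun i => x i ω) := by
  have hmeas : Measurable (fun ω i => x i ω) := measurable_pi_iff.2 hx_meas
  have hQ : IsProbabilityMeasure (pathLaw P x) := Measure.isProbabilityMeasure_map hmeas.aemeasurable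
  have hT : MeasurePreserving shift (pathLaw P x) (pathLaw P x) := hx_stat
  have hint : ∀ n, Integrable (fun u : ℕ → Fin N → ℝ => u 0 n) (pathLaw P x) := fun n => by
    have hm : Measurable fun u : ℕ → Fin N → ℝ => u 0 n :=
      (measurable_pi_apply n).comp (measurable_pi_apply 0)
    exact (integrable_map_measure hm.aestronglyMeasurable hmeas.aemeasurable).2 (hx_int n)
  have htail : ∀ᵐ u ∂(pathLaw P x), ∀ n, ∀ k : ℕ, ∃ m₀ : ℕ, ∀ m : ℕ, m₀ ≤ m → ∀ M,
      timeAvg (fun i => max 0 (u i n - m)) M ≤ 1 / ((k : ℝ) + 1) := by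
    rw [ae_all_iff]; intro n
    rw [ae_all_iff]; intro k
    exact ae_tail_small hT n (hint n) (by positivity)
  have hfreq : ∀ᵐ u ∂(pathLaw P x), ∀ (m : ℕ) (c : Fin N → ℕ), ∃ f : ℝ,
      Tendsto (fun M => timeAvg (fun i =>
        if cell m (u i) = c then 1 else 0) M) atTop (𝓝 f) := by
    rw [ae_all_iff]; intro m
    rw [ae_all_iff]; intro c
    refine ae_exists_tendsto_timeAvg hT
      (φ := fun e : Fin N → ℝ => if cell m e = c then 1 else 0) ?_ ?_ ?_
    · exact Measurable.ite (measurable_cell m (measurableSet_singleton c)) measurable_const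
        measurable_const
    · intro e; split_ifs <;> norm_num
    · intro e; split_ifs <;> norm_num
  filter_upwards [hx_nonneg, ae_of_ae_map hmeas.aemeasurable htail,
    ae_of_ae_map hmeas.aemeasurable hfreq] with ω h1 h2 h3
  refine ⟨h1, fun n δ hδ => ?_, h3⟩
  obtain ⟨k, hk⟩ := exists_nat_one_div_lt hδ
  obtain ⟨m₀, hm₀⟩ := h2 n k
  exact ⟨m₀, fun m hm M => (hm₀ m hm M).trans hk.le⟩

/-! ### Time averages -/

lemma timeAvg_eq_sum (f : ℕ → ℝ) (M : ℕ) :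
    timeAvg f M = ∑ i ∈ Finset.range M, 1 / (M : ℝ) * f i := by
  rw [timeAvg, Finset.mul_sum]

lemma timeAvg_nonneg {f : ℕ → ℝ} (h : ∀ i, 0 ≤ f i) (M : ℕ) : 0 ≤ timeAvg f M :=
  mul_nonneg (by positivity) (Finset.sum_nonneg fun i _ => h i)

lemma timeAvg_mono {f g : ℕ → ℝ} (h : ∀ i, f i ≤ g i) (M : ℕ) : timeAvg f M ≤ timeAvg g M :=
  mul_le_mul_of_nonneg_left (Finset.sum_le_sum fun i _ => h i) (by positivity)

lemma timeAvg_add (f g : ℕ → ℝ) (M : ℕ) :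
    timeAvg (fun i => f i + g i) M = timeAvg f M + timeAvg g M := by
  simp only [timeAvg, Finset.sum_add_distrib, mul_add]

lemma timeAvg_sub (f g : ℕ → ℝ) (M : ℕ) :
    timeAvg (fun i => f i - g i) M = timeAvg f M - timeAvg g M := by
  simp only [timeAvg, Finset.sum_sub_distrib, mul_sub]

lemma timeAvg_const_mul (c : ℝ) (f : ℕ → ℝ) (M : ℕ) :
    timeAvg (fun i => c * f i) M = c * timeAvg f M := by
  simp only [timeAvg, ← Finset.mul_sum]; ring

lemma timeAvg_finset_sum {ι : Type*} (s : Finset ι) (f : ι → ℕ → ℝ) (M : ℕ) :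
    timeAvg (fun i => ∑ k ∈ s, f k i) M = ∑ k ∈ s, timeAvg (f k) M := by
  simp only [timeAvg]
  rw [Finset.sum_comm, Finset.mul_sum]

lemma timeAvg_const (c : ℝ) {M : ℕ} (hM : 0 < M) : timeAvg (fun _ => c) M = c := by
  have : (M : ℝ) ≠ 0 := by exact_mod_cast hM.ne'
  simp only [timeAvg, Finset.sum_const, Finset.card_range, nsmul_eq_mul]
  field_simp

lemma timeAvg_const_le {c : ℝ} (hc : 0 ≤ c) (M : ℕ) : timeAvg (fun _ => c) M ≤ c := by
  rcases Nat.eq_zero_or_pos M with rfl | hM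
  · simpa [timeAvg] using hc
  · exact (timeAvg_const c hM).le

lemma abs_timeAvg_le (f : ℕ → ℝ) (M : ℕ) : |timeAvg f M| ≤ timeAvg (fun i => |f i|) M := by
  unfold timeAvg
  rw [abs_mul, abs_of_nonneg (by positivity : (0 : ℝ) ≤ 1 / M)]
  exact mul_le_mul_of_nonneg_left (Finset.abs_sum_le_sum_abs _ _) (by positivity)

lemma timeAvg_le_iff {f : ℕ → ℝ} {M : ℕ} (hM : 0 < M) {c : ℝ} :
    timeAvg f M ≤ c ↔ ∑ i ∈ Finset.range M, f i ≤ c * M := by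
  have : (0 : ℝ) < M := by exact_mod_cast hM
  rw [timeAvg, one_div, inv_mul_le_iff₀ this, mul_comm]

/-- Bounds `τ * M + K` valid for every `M` are the working form of a vanishing average: `K` absorbs
the initial slots, so inductions on `M` need no threshold. -/
lemma tendsto_timeAvg_of_forall_abs_le {f : ℕ → ℝ}
    (h : ∀ τ : ℝ, 0 < τ → ∃ K : ℝ, ∀ M : ℕ, |∑ i ∈ Finset.range M, f i| ≤ τ * M + K) :
    Tendsto (timeAvg f) atTop (𝓝 0) := by
  rw [Metric.tendsto_atTop]
  intro τ hτ
  obtain ⟨K, hK⟩ := h (τ / 2) (by positivity)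
  obtain ⟨M₀, hM₀⟩ := exists_nat_gt (K / (τ / 2))
  refine ⟨M₀ + 1, fun M hM => ?_⟩
  have hM1 : (M₀ : ℝ) + 1 ≤ M := by exact_mod_cast hM
  have hMpos : (0 : ℝ) < M := by linarith [M₀.cast_nonneg (α := ℝ)]
  rw [Real.dist_eq, sub_zero, timeAvg, abs_mul, abs_of_pos (by positivity), one_div,
    inv_mul_lt_iff₀ hMpos]
  rw [div_lt_iff₀ (by positivity)] at hM₀
  nlinarith [hK M]

lemma tendsto_timeAvg_of_forall_le {f : ℕ → ℝ} (h0 : ∀ i, 0 ≤ f i)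
    (h : ∀ τ : ℝ, 0 < τ → ∃ K : ℝ, ∀ M : ℕ, ∑ i ∈ Finset.range M, f i ≤ τ * M + K) :
    Tendsto (timeAvg f) atTop (𝓝 0) := by
  refine tendsto_timeAvg_of_forall_abs_le fun τ hτ => ?_
  obtain ⟨K, hK⟩ := h τ hτ
  exact ⟨K, fun M => by rw [abs_of_nonneg (Finset.sum_nonneg fun i _ => h0 i)]; exact hK M⟩

lemma exists_abs_sum_le_of_tendsto {f : ℕ → ℝ} (h : Tendsto (timeAvg f) atTop (𝓝 0)) {τ : ℝ}
    (hτ : 0 < τ) : ∃ K : ℝ, 0 ≤ K ∧ ∀ M : ℕ, |∑ i ∈ Finset.range M, f i| ≤ τ * M + K := by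
  obtain ⟨M₀, hM₀⟩ := Metric.tendsto_atTop.1 h τ hτ
  refine ⟨∑ M ∈ Finset.range M₀, |∑ i ∈ Finset.range M, f i|,
    Finset.sum_nonneg fun _ _ => abs_nonneg _, fun M => ?_⟩
  rcases lt_or_ge M M₀ with hM | hM
  · have := Finset.single_le_sum (f := fun M => |∑ i ∈ Finset.range M, f i|)
      (fun _ _ => abs_nonneg _) (Finset.mem_range.2 hM)
    have h2 : 0 ≤ τ * M := by positivity
    linarith
  · have hK : 0 ≤ ∑ M ∈ Finset.range M₀, |∑ i ∈ Finset.range M, f i| :=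
      Finset.sum_nonneg fun _ _ => abs_nonneg _
    rcases Nat.eq_zero_or_pos M with rfl | hpos
    · simpa using hK
    · have hMpos : (0 : ℝ) < M := by exact_mod_cast hpos
      have h1 := hM₀ M hM
      rw [Real.dist_eq, sub_zero, timeAvg, abs_mul, abs_of_pos (by positivity), one_div,
        inv_mul_lt_iff₀ hMpos] at h1
      linarith

/-! ### The weighted sum rate as a function of the received powers -/

/-- The weighted sum rate for received powers `r`. -/
def sumRate (S : System N) (r : Fin N → ℝ) : ℝ :=
  ∑ n, S.μ n * Real.logb 2 (1 + r n / (1 + ∑ k ∈ Finset.univ.filter (fun k => k < n), r k))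

lemma sum_mul_sicRate (S : System N) (p g : Fin N → ℝ) :
    ∑ n, S.μ n * sicRate p g n = sumRate S (fun k => p k * g k) := rfl

/-- The modulus constant of the weighted sum rate. -/
def rateConst (S : System N) : ℝ := ∑ n, |S.μ n| * (2 / Real.log 2)

lemma rateConst_nonneg (S : System N) : 0 ≤ rateConst S :=
  Finset.sum_nonneg fun n _ => mul_nonneg (abs_nonneg _)
    (div_nonneg (by norm_num) (Real.log_nonneg (by norm_num)))

/-- With `s = √t`, the cubic Taylor polynomial of `exp s` exceeds `1 + s ^ 2` by `s * (s ^ 2 / 6 - s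
/ 2 + 1)`, whose quadratic factor is positive. -/
lemma log_one_add_le_sqrt {t : ℝ} (ht : 0 ≤ t) : Real.log (1 + t) ≤ √t := by
  have h : 1 + t ≤ Real.exp (√t) := by
    have h2 := Real.sum_le_exp_of_nonneg (Real.sqrt_nonneg t) 4
    have h3 := Real.sq_sqrt ht
    have h4 := Real.sqrt_nonneg t
    simp [Finset.sum_range_succ, Nat.factorial] at h2
    set s := √t
    have : s * (s ^ 2 / 6 - s / 2 + 1) ≥ 0 :=
      mul_nonneg h4 (by nlinarith [sq_nonneg (s - 3 / 2)])
    nlinarith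
  calc Real.log (1 + t) ≤ Real.log (Real.exp (√t)) := Real.log_le_log (by linarith) h
    _ = √t := Real.log_exp _

/-- For `v ≤ u` the quotient `(1 + u) / (1 + v)` is at most `1 + (u - v)`. -/
lemma abs_log_one_add_sub_le {u v : ℝ} (hu : 0 ≤ u) (hv : 0 ≤ v) :
    |Real.log (1 + u) - Real.log (1 + v)| ≤ √|u - v| := by
  have key : ∀ u v : ℝ, 0 ≤ v → v ≤ u → Real.log (1 + u) - Real.log (1 + v) ≤ √|u - v| := by
    intro u v hv huv
    rw [← Real.log_div (by linarith) (by linarith), abs_of_nonneg (by linarith)]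
    refine le_trans (Real.log_le_log (div_pos (by linarith) (by linarith)) ?_) (log_one_add_le_sqrt (by linarith))
    rw [div_le_iff₀ (by linarith)]
    nlinarith
  rcases le_total v u with h | h
  · rw [abs_of_nonneg (sub_nonneg.2 (Real.log_le_log (by linarith) (by linarith)))]
    exact key u v hv h
  · rw [abs_sub_comm, abs_of_nonneg (sub_nonneg.2 (Real.log_le_log (by linarith) (by linarith))),
      abs_sub_comm]
    exact key v u hu h

lemma sqrt_add_le_add_sqrt {u v : ℝ} (hu : 0 ≤ u) (hv : 0 ≤ v) : √(u + v) ≤ √u + √v := by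
  rw [Real.sqrt_le_left (by positivity)]
  nlinarith [Real.sq_sqrt hu, Real.sq_sqrt hv, mul_nonneg (Real.sqrt_nonneg u) (Real.sqrt_nonneg v)]

lemma sqrt_sum_le_sum_sqrt {ι : Type*} (s : Finset ι) (f : ι → ℝ) (h : ∀ i, 0 ≤ f i) :
    √(∑ i ∈ s, f i) ≤ ∑ i ∈ s, √(f i) := by
  classical
  induction s using Finset.induction_on with
  | empty => simp
  | insert a s ha ih =>
    rw [Finset.sum_insert ha, Finset.sum_insert ha]
    exact (sqrt_add_le_add_sqrt (h a) (Finset.sum_nonneg fun i _ => h i)).trans (add_le_add le_rfl ih)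

/-- Each user's rate is a difference of two logarithms of partial sums of received powers, whence
the factor 2 in `rateConst`. A square root is preferred to a Lipschitz bound because it splits a
product of power error and gain into factors suited to Cauchy–Schwarz. -/
lemma abs_sumRate_sub_le (S : System N) {r r' : Fin N → ℝ} (hr : ∀ k, 0 ≤ r k)
    (hr' : ∀ k, 0 ≤ r' k) :
    |sumRate S r - sumRate S r'| ≤ rateConst S * ∑ k, √|r k - r' k| := by
  have hlog2 : 0 < Real.log 2 := Real.log_pos (by norm_num)
  have hpart : ∀ s : Finset (Fin N), |Real.log (1 + ∑ k ∈ s, r k) - Real.log (1 + ∑ k ∈ s, r' k)|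
      ≤ ∑ k, √|r k - r' k| := by
    intro s
    refine (abs_log_one_add_sub_le (Finset.sum_nonneg fun k _ => hr k)
      (Finset.sum_nonneg fun k _ => hr' k)).trans ?_
    rw [← Finset.sum_sub_distrib]
    refine (Real.sqrt_le_sqrt (Finset.abs_sum_le_sum_abs _ _)).trans ?_
    refine (sqrt_sum_le_sum_sqrt s _ fun k => abs_nonneg _).trans ?_
    exact Finset.sum_le_sum_of_subset_of_nonneg (Finset.subset_univ _)
      fun _ _ _ => Real.sqrt_nonneg _
  have hterm : ∀ (q : Fin N → ℝ), (∀ k, 0 ≤ q k) → ∀ n,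
      Real.logb 2 (1 + q n / (1 + ∑ k ∈ Finset.univ.filter (fun k => k < n), q k))
      = (Real.log (1 + ∑ k ∈ insert n (Finset.univ.filter (fun k => k < n)), q k)
        - Real.log (1 + ∑ k ∈ Finset.univ.filter (fun k => k < n), q k)) / Real.log 2 := by
    intro q hq n
    have h1 : 0 ≤ ∑ k ∈ Finset.univ.filter (fun k => k < n), q k :=
      Finset.sum_nonneg fun k _ => hq k
    rw [Finset.sum_insert (by simp), Real.logb, ← Real.log_div
      (by have := hq n; positivity) (by positivity)]
    congr 2
    field_simp
    ring
  unfold sumRate rateConst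
  rw [← Finset.sum_sub_distrib, Finset.sum_mul]
  refine (Finset.abs_sum_le_sum_abs _ _).trans (Finset.sum_le_sum fun n _ => ?_)
  rw [← mul_sub, abs_mul, hterm r hr, hterm r' hr', mul_assoc]
  refine mul_le_mul_of_nonneg_left ?_ (abs_nonneg _)
  rw [← sub_div, abs_div, abs_of_pos hlog2, div_mul_eq_mul_div]
  refine div_le_div_of_nonneg_right ?_ hlog2.le
  have h1 := abs_le.1 (hpart (insert n (Finset.univ.filter (fun k => k < n))))
  have h2 := abs_le.1 (hpart (Finset.univ.filter (fun k => k < n)))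
  rw [abs_le]
  constructor <;> linarith [h1.1, h1.2, h2.1, h2.2]

lemma sumRate_zero (S : System N) : sumRate S (fun _ => 0) = 0 := by simp [sumRate]

/-- Averages of the weighted sum rate depend continuously on the average powers. -/
lemma sum_abs_sumRate_sub_le (S : System N) {κ : Type*} (s : Finset κ) {b : κ → ℝ}
    {r r' e g : κ → Fin N → ℝ} (hb : ∀ i ∈ s, 0 ≤ b i) (hr : ∀ i k, 0 ≤ r i k)
    (hr' : ∀ i k, 0 ≤ r' i k) (he : ∀ i k, 0 ≤ e i k) (hg : ∀ i k, 0 ≤ g i k)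
    (h : ∀ i k, |r i k - r' i k| ≤ e i k * g i k) :
    ∑ i ∈ s, b i * |sumRate S (r i) - sumRate S (r' i)|
      ≤ rateConst S * ∑ k, √((∑ i ∈ s, b i * e i k) * ∑ i ∈ s, b i * g i k) := by
  have h1 : ∀ i ∈ s, b i * |sumRate S (r i) - sumRate S (r' i)|
      ≤ rateConst S * ∑ k, √(b i * e i k) * √(b i * g i k) := by
    intro i hi
    refine (mul_le_mul_of_nonneg_left (abs_sumRate_sub_le S (hr i) (hr' i)) (hb i hi)).trans ?_
    rw [mul_left_comm]
    refine mul_le_mul_of_nonneg_left ?_ (rateConst_nonneg S)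
    rw [Finset.mul_sum]
    refine Finset.sum_le_sum fun k _ => ?_
    rw [← Real.sqrt_mul (mul_nonneg (hb i hi) (he i k)),
      show b i * e i k * (b i * g i k) = b i ^ 2 * (e i k * g i k) by ring,
      Real.sqrt_mul (sq_nonneg _), Real.sqrt_sq (hb i hi)]
    exact mul_le_mul_of_nonneg_left (Real.sqrt_le_sqrt (h i k)) (hb i hi)
  refine (Finset.sum_le_sum h1).trans ?_
  rw [← Finset.mul_sum, Finset.sum_comm]
  refine mul_le_mul_of_nonneg_left (Finset.sum_le_sum fun k _ => ?_) (rateConst_nonneg S)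
  rw [Real.sqrt_mul (Finset.sum_nonneg fun i hi => mul_nonneg (hb i hi) (he i k))]
  -- Cauchy–Schwarz over the slots separates power errors from gains, so that only their first
  -- moments enter.
  have h2 := Real.sum_mul_le_sqrt_mul_sqrt s (fun i => √(b i * e i k)) (fun i => √(b i * g i k))
  refine h2.trans (le_of_eq ?_)
  congr 2
  · exact Finset.sum_congr rfl fun i hi => Real.sq_sqrt (mul_nonneg (hb i hi) (he i k))
  · exact Finset.sum_congr rfl fun i hi => Real.sq_sqrt (mul_nonneg (hb i hi) (hg i k))

lemma abs_sum_sumRate_sub_le (S : System N) {κ : Type*} (s : Finset κ) {b : κ → ℝ}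
    {r r' e g : κ → Fin N → ℝ} (hb : ∀ i ∈ s, 0 ≤ b i) (hr : ∀ i k, 0 ≤ r i k)
    (hr' : ∀ i k, 0 ≤ r' i k) (he : ∀ i k, 0 ≤ e i k) (hg : ∀ i k, 0 ≤ g i k)
    (h : ∀ i k, |r i k - r' i k| ≤ e i k * g i k) :
    |∑ i ∈ s, b i * sumRate S (r i) - ∑ i ∈ s, b i * sumRate S (r' i)|
      ≤ rateConst S * ∑ k, √((∑ i ∈ s, b i * e i k) * ∑ i ∈ s, b i * g i k) := by
  rw [← Finset.sum_sub_distrib]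
  refine (Finset.abs_sum_le_sum_abs _ _).trans ?_
  refine le_trans (le_of_eq ?_) (sum_abs_sumRate_sub_le S s hb hr hr' he hg h)
  exact Finset.sum_congr rfl fun i hi => by rw [← mul_sub, abs_mul, abs_of_nonneg (hb i hi)]

lemma abs_timeAvg_sumRate_sub_le (S : System N) {b : ℕ → ℝ} {r r' e g : ℕ → Fin N → ℝ}
    (hb : ∀ i, 0 ≤ b i) (hr : ∀ i k, 0 ≤ r i k) (hr' : ∀ i k, 0 ≤ r' i k)
    (he : ∀ i k, 0 ≤ e i k) (hg : ∀ i k, 0 ≤ g i k)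
    (h : ∀ i k, |r i k - r' i k| ≤ e i k * g i k) (M : ℕ) :
    |timeAvg (fun i => b i * sumRate S (r i)) M - timeAvg (fun i => b i * sumRate S (r' i)) M|
      ≤ rateConst S * ∑ k, √(timeAvg (fun i => b i * e i k) M * timeAvg (fun i => b i * g i k) M) := by
  simp only [timeAvg_eq_sum, ← mul_assoc]
  exact abs_sum_sumRate_sub_le S (Finset.range M) (fun i _ => mul_nonneg (by positivity) (hb i))
    hr hr' he hg h

lemma batteryProblem_rate (S : System N) (x : ℕ → Fin N → ℝ) (π : Policy N) (M : ℕ) :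
    (batteryProblem S x).rate π M = timeAvg (fun i =>
      (1 - π.a i) * sumRate S (fun k => delivered S x π k i * x i k)) M := by
  change ∑ n, S.μ n * timeAvg _ M = _
  simp only [← sum_mul_sicRate, Finset.mul_sum]
  rw [timeAvg_finset_sum]
  refine Finset.sum_congr rfl fun n _ => ?_
  rw [← timeAvg_const_mul]
  congr 1; ext i; ring

lemma balanceProblem_rate (S : System N) (x : ℕ → Fin N → ℝ) (π : Policy N) (M : ℕ) :
    (balanceProblem S x).rate π M = timeAvg (fun i =>
      (1 - π.a i) * sumRate S (fun k => π.Pd k i * x i k)) M := by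
  change timeAvg _ M = _
  simp only [← sum_mul_sicRate, Finset.mul_sum]
  congr 1; ext i
  exact Finset.sum_congr rfl fun n _ => by ring

lemma RegularGains.exists_timeAvg_le {x : ℕ → Fin N → ℝ} (hx : RegularGains x) :
    ∃ X : ℝ, 0 < X ∧ ∀ n M, timeAvg (fun i => x i n) M ≤ X := by
  choose m hm using fun n => hx.tail n 1 one_pos
  refine ⟨1 + ∑ n, (m n : ℝ), by positivity, fun n M => ?_⟩
  have h1 := hm n (m n) le_rfl M
  have h2 : timeAvg (fun i => x i n) M
      ≤ timeAvg (fun i => max 0 (x i n - m n) + m n) M :=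
    timeAvg_mono (fun i => by linarith [le_max_right 0 (x i n - m n)]) M
  rw [timeAvg_add] at h2
  have h3 := timeAvg_const_le (m n).cast_nonneg (c := (m n : ℝ)) M
  have h4 : (m n : ℝ) ≤ ∑ n, (m n : ℝ) :=
    Finset.single_le_sum (f := fun n => (m n : ℝ)) (fun n _ => (m n).cast_nonneg)
      (Finset.mem_univ n)
  linarith

/-! ### Battery dynamics: from the energy balance to the battery problem -/

section Battery

variable {S : System N} {x : ℕ → Fin N → ℝ} {π : Policy N}

lemma System.ε_pos (S : System N) : 0 < S.ε := one_pos.trans S.one_lt_ε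

lemma System.η'_nonneg (S : System N) : 0 ≤ S.η' :=
  div_nonneg (mul_nonneg S.η_pos.le S.N₀_pos.le) S.ε_pos.le

lemma System.ε_mul_η' (S : System N) : S.ε * S.η' = S.η * S.N₀ := by
  have := S.ε_pos.ne'
  unfold System.η'
  field_simp

lemma BasicConstraints.a_nonneg (h : BasicConstraints S π) (i : ℕ) : 0 ≤ π.a i := by
  rcases h.boolean i with h | h <;> norm_num [h]

lemma BasicConstraints.one_sub_a_nonneg (h : BasicConstraints S π) (i : ℕ) : 0 ≤ 1 - π.a i := by
  rcases h.boolean i with h | h <;> norm_num [h]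

lemma BasicConstraints.harvest_nonneg (h : BasicConstraints S π) {i : ℕ} {n : Fin N}
    (hx : 0 ≤ x i n) : 0 ≤ S.η' * π.a i * π.P0 i * x i n :=
  mul_nonneg (mul_nonneg (mul_nonneg S.η'_nonneg (h.a_nonneg i)) (h.peak_power i).1) hx

lemma battery_succ (S : System N) (x : ℕ → Fin N → ℝ) (π : Policy N) (n : Fin N) (i : ℕ) :
    battery S x π n (i + 1) = battery S x π n i + S.ε * (S.η' * π.a i * π.P0 i * x i n)
      - S.ε * ((1 - π.a i) * delivered S x π n i) := by
  change battery S x π n i + π.a i * S.η * S.N₀ * π.P0 i * x i n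
      - (1 - π.a i) * S.ε * delivered S x π n i = _
  have h := S.ε_mul_η'
  linear_combination -(π.a i * π.P0 i * x i n) * h

lemma battery_nonneg (h : BasicConstraints S π) (hx : ∀ i n, 0 ≤ x i n) (n : Fin N) (i : ℕ) :
    0 ≤ battery S x π n i := by
  induction i with
  | zero => exact S.B₀_nonneg n
  | succ i ih =>
    rw [battery_succ]
    have h1 := h.harvest_nonneg (hx i n)
    have h2 : delivered S x π n i ≤ battery S x π n i / S.ε := min_le_left _ _
    rw [le_div_iff₀ S.ε_pos] at h2
    have h3 := mul_nonneg S.ε_pos.le h1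
    rcases h.boolean i with ha | ha
    · rw [ha] at h3 ⊢; linarith
    · rw [ha] at h3 ⊢; linarith

lemma delivered_nonneg (h : BasicConstraints S π) (hx : ∀ i n, 0 ≤ x i n) (n : Fin N) (i : ℕ) :
    0 ≤ delivered S x π n i :=
  le_min (div_nonneg (battery_nonneg h hx n i) S.ε_pos.le) (h.desired_nonneg n i)

lemma delivered_le_desired (n : Fin N) (i : ℕ) : delivered S x π n i ≤ π.Pd n i := min_le_right _ _

lemma battery_eq (S : System N) (x : ℕ → Fin N → ℝ) (π : Policy N) (n : Fin N) (M : ℕ) :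
    battery S x π n M = S.B₀ n + S.ε * ∑ i ∈ Finset.range M, S.η' * π.a i * π.P0 i * x i n
      - S.ε * ∑ i ∈ Finset.range M, (1 - π.a i) * delivered S x π n i := by
  induction M with
  | zero => simp [battery]
  | succ M ih => rw [battery_succ, ih, Finset.sum_range_succ, Finset.sum_range_succ]; ring

/-- The energy a user has spent was stored initially or harvested. -/
lemma sum_delivered_le (h : BasicConstraints S π) (hx : ∀ i n, 0 ≤ x i n) (n : Fin N) (M : ℕ) :
    ∑ i ∈ Finset.range M, (1 - π.a i) * delivered S x π n i
      ≤ S.B₀ n / S.ε + ∑ i ∈ Finset.range M, S.η' * π.a i * π.P0 i * x i n := by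
  have h1 := battery_nonneg h hx n M
  rw [battery_eq] at h1
  rw [← sub_le_iff_le_add, le_div_iff₀ S.ε_pos]
  linarith

/-- The shortfall grows only in slots that empty the battery. -/
lemma sum_shortfall_le (h : BasicConstraints S π) (n : Fin N) {τ K : ℝ}
    (hτ : 0 ≤ τ) (hK : 0 ≤ K)
    (hbal : ∀ M : ℕ, |∑ i ∈ Finset.range M, ((1 - π.a i) * π.Pd n i
      - S.η' * π.a i * π.P0 i * x i n)| ≤ τ * M + K) (M : ℕ) :
    ∑ i ∈ Finset.range M, (1 - π.a i) * (π.Pd n i - delivered S x π n i) ≤ τ * M + K := by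
  induction M with
  | zero => simpa using hK
  | succ M ih =>
    have hmono : τ * (M : ℝ) + K ≤ τ * ((M + 1 : ℕ) : ℝ) + K := by push_cast; linarith
    rcases h.boolean M with ha | ha
    · rcases min_choice (battery S x π n M / S.ε) (π.Pd n M) with hmin | hmin
      -- Everything stored and harvested has now been spent, so the total shortfall equals the total
      -- imbalance minus `S.B₀ n / S.ε`. In the other two cases the slot adds no shortfall.
      · have hzero : battery S x π n (M + 1) = 0 := by
          have hd : delivered S x π n M = battery S x π n M / S.ε := hmin
          rw [battery_succ, ha, hd]
          have := S.ε_pos.ne'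
          field_simp
          ring
        rw [battery_eq] at hzero
        have h1 := (abs_le.1 (hbal (M + 1))).2
        rw [Finset.sum_sub_distrib] at h1
        simp only [mul_sub, Finset.sum_sub_distrib]
        have h2 := S.B₀_nonneg n
        have h3 : S.ε * (∑ i ∈ Finset.range (M + 1), S.η' * π.a i * π.P0 i * x i n
            - ∑ i ∈ Finset.range (M + 1), (1 - π.a i) * delivered S x π n i) ≤ 0 := by
          linarith
        have h4 := nonpos_of_mul_nonpos_right h3 S.ε_pos
        linarith
      · have hd : delivered S x π n M = π.Pd n M := hmin
        rw [Finset.sum_range_succ, hd]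
        linarith
    · rw [Finset.sum_range_succ, ha]
      linarith

theorem tendsto_timeAvg_shortfall (hπ : (balanceProblem S x).Feasible π)
    (n : Fin N) : Tendsto (timeAvg fun i => (1 - π.a i) * (π.Pd n i - delivered S x π n i)) atTop (𝓝 0) := by
  obtain ⟨h, hbal⟩ := hπ
  refine tendsto_timeAvg_of_forall_le (fun i => mul_nonneg (h.one_sub_a_nonneg i)
    (sub_nonneg.2 (delivered_le_desired n i))) fun τ hτ => ?_
  have h1 := hbal n
  simp only [← timeAvg_sub] at h1
  obtain ⟨K, hK, hKM⟩ := exists_abs_sum_le_of_tendsto h1 hτ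
  exact ⟨K, sum_shortfall_le h n hτ.le hK hKM⟩

/-- The power error is the shortfall, whose average vanishes, while the average gains stay bounded
by `X`. -/
theorem tendsto_rate_sub (hreg : RegularGains x) (hπ : (balanceProblem S x).Feasible π) :
    Tendsto (fun M => (batteryProblem S x).rate π M - (balanceProblem S x).rate π M)
      atTop (𝓝 0) := by
  have hx := hreg.nonneg
  have h := hπ.1
  obtain ⟨X, hX, hXM⟩ := hreg.exists_timeAvg_le
  have hbound : ∀ M, ‖(batteryProblem S x).rate π M - (balanceProblem S x).rate π M‖
      ≤ rateConst S * ∑ k, √(timeAvg (fun i => (1 - π.a i) *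
        (π.Pd k i - delivered S x π k i)) M * X) := by
    intro M
    rw [batteryProblem_rate, balanceProblem_rate, Real.norm_eq_abs]
    refine (abs_timeAvg_sumRate_sub_le S h.one_sub_a_nonneg
      (fun i k => mul_nonneg (delivered_nonneg h hx k i) (hx i k))
      (fun i k => mul_nonneg (h.desired_nonneg k i) (hx i k))
      (e := fun i k => π.Pd k i - delivered S x π k i) (g := x)
      (fun i k => sub_nonneg.2 (delivered_le_desired k i)) hx (fun i k => ?_) M).trans ?_
    · rw [← sub_mul, abs_mul, abs_of_nonneg (hx i k), abs_sub_comm,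
        abs_of_nonneg (sub_nonneg.2 (delivered_le_desired k i))]
    · refine mul_le_mul_of_nonneg_left (Finset.sum_le_sum fun k _ => Real.sqrt_le_sqrt ?_)
        (rateConst_nonneg S)
      refine mul_le_mul_of_nonneg_left ((timeAvg_mono (fun i => ?_) M).trans (hXM k M))
        (timeAvg_nonneg (fun i => mul_nonneg (h.one_sub_a_nonneg i)
          (sub_nonneg.2 (delivered_le_desired k i))) M)
      nlinarith [h.a_nonneg i, hx i k]
  refine squeeze_zero_norm hbound ?_
  have hlim : Tendsto (fun M => rateConst S * ∑ k, √(timeAvg (fun i => (1 - π.a i) *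
        (π.Pd k i - delivered S x π k i)) M * X)) atTop
      (𝓝 (rateConst S * ∑ _k : Fin N, √(0 * X))) :=
    (tendsto_finsetSum _ fun k _ => (Real.continuous_sqrt.tendsto _).comp
      ((tendsto_timeAvg_shortfall hπ k).mul_const X)).const_mul _
  simpa using hlim

theorem objective_eq (hreg : RegularGains x) (hπ : (balanceProblem S x).Feasible π) :
    (batteryProblem S x).objective π = (balanceProblem S x).objective π := by
  have hlim := tendsto_rate_sub hreg hπ
  have key : ∀ u v : ℕ → ℝ, Tendsto (fun M => u M - v M) atTop (𝓝 0) →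
      liminf (fun M => ((u M : ℝ) : EReal)) atTop ≤ liminf (fun M => ((v M : ℝ) : EReal)) atTop := by
    intro u v huv
    refine EReal.le_of_forall_lt_iff_le.1 fun c hc => ?_
    by_contra hlt
    push Not at hlt
    obtain ⟨d, hd1, hd2⟩ := EReal.lt_iff_exists_real_btwn.1 hlt
    have h1 := eventually_lt_of_lt_liminf hd2
    have hcd : c < d := by exact_mod_cast hd1
    have h2 := (tendsto_order.1 huv).2 (d - c) (by linarith)
    have h3 : (c : EReal) ≤ liminf (fun M => ((v M : ℝ) : EReal)) atTop := by
      refine le_liminf_of_le ?_ ?_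
      · isBoundedDefault
      filter_upwards [h1, h2] with M hM1 hM2
      have : d < u M := by exact_mod_cast hM1
      exact_mod_cast (by linarith : c ≤ v M)
    exact absurd hc (not_lt.2 h3)
  refine le_antisymm (key _ _ hlim) (key _ _ ?_)
  have := hlim.neg
  simpa using this

end Battery

/-! ### Nonnegative sequences whose large values are negligible on average -/

/-- Sums over sparse sets of slots are negligible. -/
def TailSmall (z : ℕ → ℝ) : Prop :=
  ∀ δ : ℝ, 0 < δ → ∃ m : ℝ, 0 ≤ m ∧ ∀ (M : ℕ) (D : Finset ℕ), D ⊆ Finset.range M →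
    ∑ i ∈ D, z i ≤ m * D.card + δ * M

/-- Each gain is cut at level `m`: the lower part costs at most `m` per slot of `D`, the excess at
most `δ * M` in total. -/
lemma RegularGains.tailSmall {x : ℕ → Fin N → ℝ} (hx : RegularGains x) (n : Fin N) :
    TailSmall (fun i => x i n) := by
  intro δ hδ
  obtain ⟨m, hm⟩ := hx.tail n δ hδ
  refine ⟨m, m.cast_nonneg, fun M D hD => ?_⟩
  have h1 : ∑ i ∈ D, x i n ≤ ∑ i ∈ D, (max 0 (x i n - m) + m) :=
    Finset.sum_le_sum fun i _ => by linarith [le_max_right 0 (x i n - m)]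
  have h2 : ∑ i ∈ D, max 0 (x i n - m) ≤ ∑ i ∈ Finset.range M, max 0 (x i n - m) :=
    Finset.sum_le_sum_of_subset_of_nonneg hD fun _ _ _ => le_max_left _ _
  have h3 : ∑ i ∈ Finset.range M, max 0 (x i n - m) ≤ δ * M := by
    rcases Nat.eq_zero_or_pos M with rfl | hM
    · simp
    · exact (timeAvg_le_iff hM).1 (hm m le_rfl M)
  rw [Finset.sum_add_distrib, Finset.sum_const, nsmul_eq_mul] at h1
  linarith

lemma TailSmall.of_le {x z : ℕ → ℝ} (hx : TailSmall x) {A B : ℝ} (hA : 0 ≤ A) (hB : 0 ≤ B)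
    (h : ∀ i, z i ≤ A * x i + B) : TailSmall z := by
  intro δ hδ
  obtain ⟨m, hm, hD⟩ := hx (δ / (A + 1)) (by positivity)
  refine ⟨A * m + B, by positivity, fun M D hDM => ?_⟩
  have h1 : ∑ i ∈ D, z i ≤ ∑ i ∈ D, (A * x i + B) := Finset.sum_le_sum fun i _ => h i
  rw [Finset.sum_add_distrib, Finset.sum_const, nsmul_eq_mul, ← Finset.mul_sum] at h1
  have h2 := mul_le_mul_of_nonneg_left (hD M D hDM) hA
  have h3 : A * (δ / (A + 1) * M) ≤ δ * M := by
    rw [← mul_assoc]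
    refine mul_le_mul_of_nonneg_right ?_ M.cast_nonneg
    rw [← mul_div_assoc, div_le_iff₀ (by positivity)]
    nlinarith
  linarith

lemma card_filter_isSquare_le (M : ℕ) :
    ((Finset.range M).filter IsSquare).card ≤ Nat.sqrt M + 1 := by
  have : (Finset.range M).filter IsSquare ⊆ (Finset.range (Nat.sqrt M + 1)).image fun k => k * k := by
    intro i hi
    rw [Finset.mem_filter, Finset.mem_range] at hi
    obtain ⟨hi, k, rfl⟩ := hi
    exact Finset.mem_image.2 ⟨k, Finset.mem_range.2 (Nat.lt_succ_of_le (Nat.le_sqrt.2 hi.le)), rfl⟩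
  exact (Finset.card_le_card this).trans (Finset.card_image_le.trans (by simp))

/-- The arithmetic–geometric mean inequality; it absorbs a count of order √M into an arbitrarily
small multiple of `M` plus a constant. -/
lemma mul_sqrt_le (m : ℝ) {δ : ℝ} (hδ : 0 < δ) {s M : ℕ} (hs : s * s ≤ M) :
    2 * m * s ≤ δ * M + m ^ 2 / δ := by
  have h1 : (s : ℝ) * s ≤ M := by exact_mod_cast hs
  have h2 : 2 * m * s ≤ δ * (s * s) + m ^ 2 / δ := by
    have : δ * (s * s) + m ^ 2 / δ - 2 * m * s = (δ * s - m) ^ 2 / δ := by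
      field_simp; ring
    have h3 : 0 ≤ (δ * s - m) ^ 2 / δ := by positivity
    linarith
  nlinarith

lemma TailSmall.tendsto_square {z : ℕ → ℝ} (hz : TailSmall z) (h0 : ∀ i, 0 ≤ z i) :
    Tendsto (timeAvg fun i => (if IsSquare i then 1 else 0) * z i) atTop (𝓝 0) := by
  refine tendsto_timeAvg_of_forall_le
    (fun i => mul_nonneg (by split_ifs <;> norm_num) (h0 i)) fun τ hτ => ?_
  obtain ⟨m, hm, hD⟩ := hz (τ / 2) (by positivity)
  refine ⟨(m / 2) ^ 2 / (τ / 2) + m, fun M => ?_⟩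
  have h1 := hD M _ (Finset.filter_subset IsSquare (Finset.range M))
  rw [Finset.sum_filter] at h1
  have h2 := mul_le_mul_of_nonneg_left
    (show (((Finset.range M).filter IsSquare).card : ℝ) ≤ Nat.sqrt M + 1 by
      exact_mod_cast card_filter_isSquare_le M) hm
  have h3 := mul_sqrt_le (m / 2) (half_pos hτ) (Nat.sqrt_le M)
  simp only [ite_mul, one_mul, zero_mul]
  linarith

/-- A surplus can be spent in the square slots, keeping the running balance sublinear. -/
lemma TailSmall.exists_dump {z : ℕ → ℝ} (hz : TailSmall z) (h0 : ∀ i, 0 ≤ z i) :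
    ∃ w : ℕ → ℝ, (∀ i, 0 ≤ w i) ∧ (∀ i, ¬ IsSquare i → w i = 0) ∧
      Tendsto (timeAvg fun i => w i - z i) atTop (𝓝 0) := by
  -- `next i` is the first square above `i`. The amount spent before slot `M > 0` is `Z (next (M -
  -- 1))`: at a square slot, the whole surplus up to the next square is spent in advance. The
  -- balance therefore differs from zero by less than one block, of at most about `2 * √M` slots.
  let next : ℕ → ℕ := fun i => (Nat.sqrt i + 1) * (Nat.sqrt i + 1)
  let Z : ℕ → ℝ := fun k => ∑ i ∈ Finset.range k, z i
  let W : ℕ → ℝ := fun M => if M = 0 then 0 else Z (next (M - 1))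
  have hZ : Monotone Z := fun k l hkl =>
    Finset.sum_le_sum_of_subset_of_nonneg (Finset.range_mono hkl) fun i _ _ => h0 i
  have hnext : Monotone next := fun i j hij => by
    have := Nat.sqrt_le_sqrt hij
    exact Nat.mul_le_mul (by omega) (by omega)
  have hZ0 : ∀ k, 0 ≤ Z k := fun k => Finset.sum_nonneg fun i _ => h0 i
  refine ⟨fun i => W (i + 1) - W i, fun i => ?_, fun i hi => ?_, ?_⟩
  · rcases Nat.eq_zero_or_pos i with rfl | hpos
    · simpa [W] using hZ0 _
    · simp only [W, hpos.ne', if_false, Nat.succ_ne_zero, Nat.add_sub_cancel, sub_nonneg]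
      exact hZ (hnext (Nat.sub_le _ _))
  · have hpos : 0 < i := Nat.pos_of_ne_zero fun h => hi (h ▸ ⟨0, rfl⟩)
    have hs : Nat.sqrt i = Nat.sqrt (i - 1) := by
      refine le_antisymm ?_ (Nat.sqrt_le_sqrt (Nat.sub_le _ _))
      by_contra hlt
      push Not at hlt
      have h1 := Nat.lt_succ_sqrt (i - 1)
      have h2 := Nat.sqrt_le i
      have h3 : (Nat.sqrt (i - 1) + 1) * (Nat.sqrt (i - 1) + 1) ≤ Nat.sqrt i * Nat.sqrt i :=
        Nat.mul_le_mul hlt hlt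
      have h4 : i - 1 < (Nat.sqrt (i - 1) + 1) * (Nat.sqrt (i - 1) + 1) := h1
      exact hi ⟨Nat.sqrt i, by omega⟩
    simp [W, hpos.ne', next, hs]
  · refine tendsto_timeAvg_of_forall_abs_le fun τ hτ => ?_
    -- Since `next (M - 1) ≤ 3 * M`, the tails use three fifths of `τ`; absorbing the block length
    -- uses another.
    obtain ⟨m, hm, hD⟩ := hz (τ / 5) (by positivity)
    refine ⟨m ^ 2 / (τ / 5), fun M => ?_⟩
    have hK : 0 ≤ m ^ 2 / (τ / 5) := by positivity
    rw [Finset.sum_sub_distrib, Finset.sum_range_sub]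
    change |W M - W 0 - Z M| ≤ _
    rcases Nat.eq_zero_or_pos M with rfl | hpos
    · simpa [W, Z] using hK
    · have h1 : M ≤ next (M - 1) := by
        have : M - 1 < (Nat.sqrt (M - 1) + 1) * (Nat.sqrt (M - 1) + 1) := Nat.lt_succ_sqrt (M - 1)
        change M ≤ (Nat.sqrt (M - 1) + 1) * (Nat.sqrt (M - 1) + 1)
        omega
      have hs := Nat.sqrt_le (M - 1)
      set s := Nat.sqrt (M - 1) with hsdef
      have h2 : next (M - 1) ≤ M + 2 * s := by
        change (s + 1) * (s + 1) ≤ _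
        have : (s + 1) * (s + 1) = s * s + 2 * s + 1 := by ring
        omega
      have hW : W M - W 0 - Z M = ∑ i ∈ Finset.Ico M (next (M - 1)), z i := by
        rw [Finset.sum_Ico_eq_sub _ h1]
        simp [W, hpos.ne', Z]
      rw [hW, abs_of_nonneg (Finset.sum_nonneg fun i _ => h0 i)]
      have h3 := hD (next (M - 1)) (Finset.Ico M (next (M - 1))) fun i hi =>
        Finset.mem_range.2 (Finset.mem_Ico.1 hi).2
      rw [Nat.card_Ico] at h3
      have hsM : s * s ≤ M := by omega
      have h4 : ((next (M - 1) - M : ℕ) : ℝ) ≤ 2 * s := by exact_mod_cast (by omega)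
      have hs1 : s ≤ s * s := Nat.le_mul_self s
      have h5 : ((next (M - 1) : ℕ) : ℝ) ≤ 3 * M := by exact_mod_cast (by omega)
      have h6 := mul_sqrt_le m (show 0 < τ / 5 by positivity) hsM
      have h7 := mul_le_mul_of_nonneg_left h4 hm
      have h8 := mul_le_mul_of_nonneg_left h5 (show 0 ≤ τ / 5 by positivity)
      have h9 : 0 ≤ τ * M := by positivity
      linarith

/-! ### Quantized gains -/

/-- A lower approximation of the gains that takes finitely many values, each with a limiting
frequency, such that the average error is eventually at most `τ`. -/
structure Quantizer (x : ℕ → Fin N → ℝ) (τ : ℝ) (ι : Type) [Fintype ι] [DecidableEq ι] where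
  c : ℕ → ι
  y : ι → Fin N → ℝ
  f : ι → ℝ
  Y : ℝ
  Y_nonneg : 0 ≤ Y
  tendsto_freq : ∀ q, Tendsto (timeAvg fun i => if c i = q then 1 else 0) atTop (𝓝 (f q))
  y_nonneg : ∀ q n, 0 ≤ y q n
  y_le : ∀ q n, y q n ≤ Y
  y_le_gain : ∀ i n, y (c i) n ≤ x i n
  error_le : ∀ n, ∀ᶠ M in atTop, timeAvg (fun i => x i n - y (c i) n) M ≤ τ
  y_eq_zero : ∀ q, f q = 0 → ∀ n, y q n = 0

lemma RegularGains.exists_quantizer {x : ℕ → Fin N → ℝ} (hx : RegularGains x) {τ : ℝ}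
    (hτ : 0 < τ) : ∃ (ι : Type) (_ : Fintype ι) (_ : DecidableEq ι),
      Nonempty (Quantizer x τ ι) := by
  choose m₀ hm₀ using fun n => hx.tail n (τ / 3) (by positivity)
  obtain ⟨m₁, hm₁⟩ := exists_nat_gt (1 / (τ / 3))
  -- Large enough that both the step `1 / m` and all tail averages beyond `m` are at most `τ / 3`.
  let m : ℕ := m₁ + ∑ n, m₀ n
  have hm1 : 1 / (τ / 3) < m := hm₁.trans_le (by exact_mod_cast Nat.le_add_right _ _)
  have hmpos : (0 : ℝ) < m := lt_trans (by positivity) hm1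
  have hminv : 1 / (m : ℝ) ≤ τ / 3 := by
    rw [div_le_iff₀ hmpos]
    rw [div_lt_iff₀ (by positivity)] at hm1
    linarith
  have hmn : ∀ n, m₀ n ≤ m := fun n =>
    (Finset.single_le_sum (fun _ _ => Nat.zero_le _) (Finset.mem_univ n)).trans
      (Nat.le_add_left _ _)
  let c : ℕ → Fin N → Fin (m * m + 1) := fun i n =>
    ⟨cell m (x i) n, Nat.lt_succ_of_le (min_le_right _ _)⟩
  have hc : ∀ i q, c i = q ↔ cell m (x i) = fun n => (q n : ℕ) := fun i q => by
    constructor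
    · rintro rfl; rfl
    · intro h; funext n; exact Fin.ext (congrFun h n)
  choose f hf using fun q : Fin N → Fin (m * m + 1) => hx.freq m (fun n => (q n : ℕ))
  -- Cells of zero frequency get weight zero in the imitation, so they must carry neither harvest
  -- nor rate. Lowering their value to `0` costs at most `m` times their empirical frequency,
  -- eventually below `τ / 3`.
  let y : (Fin N → Fin (m * m + 1)) → Fin N → ℝ := fun q n =>
    if f q = 0 then 0 else (q n : ℕ) / (m : ℝ)
  have hfreq : ∀ q, Tendsto (timeAvg fun i => if c i = q then 1 else 0) atTop (𝓝 (f q)) := by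
    intro q
    simp only [hc]
    exact hf q
  have hle : ∀ (q : Fin N → Fin (m * m + 1)) n, ((q n : ℕ) : ℝ) / m ≤ m := fun q n => by
    rw [div_le_iff₀ hmpos]
    exact_mod_cast Nat.le_of_lt_succ (q n).2
  have hcell : ∀ i n, ((c i n : ℕ) : ℝ) / m ≤ x i n := fun i n => by
    rw [div_le_iff₀ hmpos]
    refine le_trans ?_ (Nat.floor_le (mul_nonneg (hx.nonneg i n) hmpos.le))
    exact_mod_cast min_le_left _ _
  have herr : ∀ i n, x i n - ((c i n : ℕ) : ℝ) / m ≤ 1 / m + max 0 (x i n - m) := fun i n => by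
    rcases min_choice ⌊x i n * m⌋₊ (m * m) with h | h
    · have h1 : (c i n : ℕ) = ⌊x i n * m⌋₊ := h
      have h2 := (Nat.lt_floor_add_one (x i n * m)).le
      rw [h1, sub_le_iff_le_add, add_right_comm, ← add_div]
      rw [← le_div_iff₀ hmpos] at h2
      linarith [le_max_left 0 (x i n - m), add_comm (1 : ℝ) (⌊x i n * m⌋₊ : ℝ) ▸ h2]
    · have h1 : (c i n : ℕ) = m * m := h
      rw [h1]
      push_cast
      rw [mul_div_assoc, div_self hmpos.ne', mul_one]
      have : 0 ≤ 1 / (m : ℝ) := by positivity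
      linarith [le_max_right 0 (x i n - m)]
  refine ⟨Fin N → Fin (m * m + 1), inferInstance, inferInstance, ⟨{
    c := c, y := y, f := f, Y := m, Y_nonneg := hmpos.le, tendsto_freq := hfreq
    y_nonneg := fun q n => ?_, y_le := fun q n => ?_, y_le_gain := fun i n => ?_
    error_le := fun n => ?_, y_eq_zero := fun q hq n => by simp [y, hq] }⟩⟩
  · by_cases h : f q = 0
    · simp [y, h]
    · simp only [y, h, if_false]; positivity
  · by_cases h : f q = 0
    · simp only [y, h, if_true]; exact hmpos.le
    · simp only [y, h, if_false]; exact hle q n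
  · by_cases h : f (c i) = 0
    · simp only [y, h, if_true]; exact hx.nonneg i n
    · simp only [y, h, if_false]; exact hcell i n
  · let Z := Finset.univ.filter fun q => f q = 0
    have hZ : Tendsto (fun M => (m : ℝ) * timeAvg (fun i => ∑ q ∈ Z, if c i = q then 1 else 0) M)
        atTop (𝓝 0) := by
      have h1 : Tendsto (fun M => (m : ℝ) * ∑ q ∈ Z, timeAvg (fun i => if c i = q then 1 else 0) M)
          atTop (𝓝 (m * ∑ q ∈ Z, f q)) := (tendsto_finsetSum _ fun q _ => hfreq q).const_mul _
      have h2 : ∑ q ∈ Z, f q = 0 := Finset.sum_eq_zero fun q hq => (Finset.mem_filter.1 hq).2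
      rw [h2, mul_zero] at h1
      simpa only [timeAvg_finset_sum] using h1
    filter_upwards [(tendsto_order.1 hZ).2 (τ / 3) (by positivity)] with M hM
    have h1 : timeAvg (fun i => x i n - y (c i) n) M ≤ timeAvg (fun i => (1 / (m : ℝ) +
        max 0 (x i n - m)) + m * ∑ q ∈ Z, if c i = q then 1 else 0) M := by
      refine timeAvg_mono (fun i => ?_) M
      rw [Finset.sum_ite_eq]
      by_cases h : f (c i) = 0
      · have hmem : c i ∈ Z := Finset.mem_filter.2 ⟨Finset.mem_univ _, h⟩
        simp only [y, h, if_true, hmem]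
        linarith [herr i n, hle (c i) n]
      · have hmem : c i ∉ Z := fun h' => h (Finset.mem_filter.1 h').2
        simp only [y, h, if_false, hmem]
        linarith [herr i n]
    rw [timeAvg_add, timeAvg_add, timeAvg_const_mul] at h1
    have h2 := timeAvg_const_le (c := 1 / (m : ℝ)) (by positivity) M
    have h3 := hm₀ n m (hmn n) M
    linarith

/-! ### Reproducing the empirical behaviour of a finite window -/

lemma sum_ite_count (p : ℕ → Prop) [DecidablePred p] (F : ℕ → ℝ) (T : ℕ) :
    ∑ i ∈ Finset.range T, (if p i then F (Nat.count p i) else 0)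
      = ∑ k ∈ Finset.range (Nat.count p T), F k := by
  induction T with
  | zero => simp
  | succ T ih =>
    rw [Finset.sum_range_succ, ih, Nat.count_succ]
    by_cases h : p T <;> simp [h, Finset.sum_range_succ]

/-- Subtracting the mean makes the sum over a full period vanish, so the partial sums are periodic,
hence bounded. -/
lemma exists_abs_sum_mod_sub_le (G : ℕ → ℝ) {n : ℕ} (hn : 0 < n) : ∃ B : ℝ, ∀ L : ℕ,
    |∑ k ∈ Finset.range L, G (k % n) - L * ((∑ k ∈ Finset.range n, G k) / n)| ≤ B := by
  set A := (∑ k ∈ Finset.range n, G k) / n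
  let D : ℕ → ℝ := fun L => ∑ k ∈ Finset.range L, (G (k % n) - A)
  have hD : ∀ L : ℕ, ∑ k ∈ Finset.range L, G (k % n) - L * A = D L := fun L => by
    simp [D, Finset.sum_sub_distrib]
  have hper : Function.Periodic D n := fun L => by
    have h1 : D n = 0 := by
      rw [← hD, Finset.sum_congr rfl fun k hk => by rw [Nat.mod_eq_of_lt (Finset.mem_range.1 hk)]]
      have : (n : ℝ) ≠ 0 := by exact_mod_cast hn.ne'
      simp only [A]
      field_simp
      simp
    have h2 : D (n + L) = D n + D L := by
      simp only [D, Finset.sum_range_add, Nat.add_mod_left]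
    rw [add_comm, h2, h1, zero_add]
  refine ⟨∑ l ∈ Finset.range n, |D l|, fun L => ?_⟩
  rw [hD, ← hper.map_mod_nat L]
  exact Finset.single_le_sum (f := fun l => |D l|) (fun _ _ => abs_nonneg _)
    (Finset.mem_range.2 (Nat.mod_lt _ hn))

lemma sum_ite_eq_count (p : ℕ → Prop) [DecidablePred p] (T : ℕ) :
    ∑ i ∈ Finset.range T, (if p i then (1 : ℝ) else 0) = Nat.count p T := by
  simpa using sum_ite_count p (fun _ => 1) T

/-- Cycling through the visits to a set within `[0, M)` reproduces their average. -/
lemma tendsto_timeAvg_cyclic (p : ℕ → Prop) [DecidablePred p] {d : ℝ}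
    (hd : Tendsto (timeAvg fun i => if p i then 1 else 0) atTop (𝓝 d)) {M : ℕ}
    (hM : 0 < Nat.count p M) (g : ℕ → ℝ) :
    Tendsto (timeAvg fun i =>
        if p i then g (Nat.nth p (Nat.count p i % Nat.count p M)) else 0) atTop
      (𝓝 (∑ j ∈ Finset.range M, if p j then d / Nat.count p M * g j else 0)) := by
  set n := Nat.count p M
  obtain ⟨B, hB⟩ := exists_abs_sum_mod_sub_le (fun k => g (Nat.nth p k)) hM
  set A := (∑ k ∈ Finset.range n, g (Nat.nth p k)) / n
  have hA : ∑ j ∈ Finset.range M, (if p j then d / n * g j else 0) = d * A := by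
    have h1 := sum_ite_count p (fun k => g (Nat.nth p k)) M
    have h2 : ∀ j, (if p j then d / n * g j else 0)
        = d / n * (if p j then g (Nat.nth p (Nat.count p j)) else 0) := fun j => by
      by_cases h : p j
      · simp [h, Nat.nth_count h]
      · simp [h]
    simp only [h2]
    rw [← Finset.mul_sum, h1]
    simp only [A]
    ring
  rw [hA]
  have h1 : Tendsto (timeAvg fun i => (if p i then g (Nat.nth p (Nat.count p i % n)) else 0)
      - A * (if p i then 1 else 0)) atTop (𝓝 0) := by
    refine tendsto_timeAvg_of_forall_abs_le fun τ hτ => ⟨B, fun T => ?_⟩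
    rw [Finset.sum_sub_distrib, ← Finset.mul_sum, sum_ite_eq_count,
      sum_ite_count p (fun k => g (Nat.nth p (k % n))), mul_comm A]
    have : 0 ≤ τ * T := by positivity
    linarith [hB (Nat.count p T)]
  have h2 := h1.add (hd.const_mul A)
  rw [zero_add, mul_comm A] at h2
  refine h2.congr fun T => ?_
  rw [timeAvg_sub, timeAvg_const_mul]
  ring

/-- There is a selection of slots of the window `[0, M)` under which every function of the cell and
of the selected slot has a limiting average, the cell-wise reweighted average over the window. -/
theorem exists_selection {ι : Type} [Fintype ι] [DecidableEq ι] (c : ℕ → ι) {f : ι → ℝ}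
    (hf : ∀ q, Tendsto (timeAvg fun i => if c i = q then 1 else 0) atTop (𝓝 (f q))) {M : ℕ}
    (hM : ∀ q, f q ≠ 0 → 0 < Nat.count (fun j => c j = q) M) :
    ∃ σ : ℕ → ℕ, (∀ i, σ i < M + 1) ∧ ∀ g : ι → ℕ → ℝ,
      Tendsto (timeAvg fun i => g (c i) (σ i)) atTop (𝓝 (∑ j ∈ Finset.range M,
        f (c j) / Nat.count (fun i => c i = c j) M * g (c j) j)) := by
  let n : ι → ℕ := fun q => Nat.count (fun j => c j = q) M
  -- The `k`-th visit to `q` copies visit `k % n q` of the window. Cells absent from the window have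
  -- frequency zero and copy slot `0`; this default is why the selected slots are bounded by `M +
  -- 1`, which also covers `M = 0`.
  let s : ι → ℕ → ℕ := fun q i => if n q = 0 then 0 else
    Nat.nth (fun j => c j = q) (Nat.count (fun j => c j = q) i % n q)
  have hs : ∀ q i, s q i < M + 1 := fun q i => by
    by_cases h : n q = 0
    · simp [s, h]
    · simp only [s, h, if_false]
      exact (Nat.nth_lt_of_lt_count (Nat.mod_lt _ (Nat.pos_of_ne_zero h))).trans (Nat.lt_succ_self M)
  refine ⟨fun i => s (c i) i, fun i => hs _ _, fun g => ?_⟩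
  have hq : ∀ q, Tendsto (timeAvg fun i => if c i = q then g q (s q i) else 0) atTop
      (𝓝 (∑ j ∈ Finset.range M, if c j = q then f q / n q * g q j else 0)) := by
    intro q
    by_cases h : n q = 0
    · have hfq : f q = 0 := by
        by_contra hne
        exact (hM q hne).ne' h
      have hlim : Tendsto (fun T => g q 0 * timeAvg (fun i => if c i = q then 1 else 0) T) atTop
          (𝓝 (g q 0 * f q)) := (hf q).const_mul _
      simp only [hfq, zero_div, zero_mul, mul_zero, ite_self, Finset.sum_const_zero] at hlim ⊢
      refine hlim.congr fun T => ?_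
      rw [← timeAvg_const_mul]
      simp [s, h]
    · simp only [s, h, if_false]
      exact tendsto_timeAvg_cyclic (fun j => c j = q) (hf q) (Nat.pos_of_ne_zero h) (g q)
  have hsum := tendsto_finsetSum Finset.univ fun q _ => hq q
  rw [Finset.sum_comm] at hsum
  simp only [Finset.sum_ite_eq, Finset.mem_univ, if_true, ← timeAvg_finset_sum] at hsum
  exact hsum

/-! ### Extending a window to a feasible policy over infinitely many slots -/

lemma tendsto_timeAvg_const (c : ℝ) : Tendsto (timeAvg fun _ => c) atTop (𝓝 c) := by
  refine tendsto_const_nhds.congr' ?_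
  filter_upwards [eventually_gt_atTop 0] with M hM
  exact (timeAvg_const c hM).symm

lemma RegularGains.tendsto_square_of_le {x : ℕ → Fin N → ℝ} (hx : RegularGains x) (n : Fin N)
    {z : ℕ → ℝ} (h0 : ∀ i, 0 ≤ z i) {A B : ℝ} (hA : 0 ≤ A) (hB : 0 ≤ B)
    (h : ∀ i, z i ≤ A * x i n + B) :
    Tendsto (timeAvg fun i => (if IsSquare i then 1 else 0) * z i) atTop (𝓝 0) :=
  ((hx.tailSmall n).of_le hA hB h).tendsto_square h0

/-- Comparison with zero powers. It serves for the square slots: in the dumped contribution the gain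
average vanishes, in the skipped contribution the power average does. -/
lemma tendsto_timeAvg_sumRate_zero (S : System N) {b : ℕ → ℝ} {e g : ℕ → Fin N → ℝ}
    (hb : ∀ i, 0 ≤ b i) (he : ∀ i k, 0 ≤ e i k) (hg : ∀ i k, 0 ≤ g i k) {v : Fin N → ℕ → ℝ}
    (hv : ∀ k M, timeAvg (fun i => b i * e i k) M * timeAvg (fun i => b i * g i k) M ≤ v k M)
    (hv0 : ∀ k, Tendsto (v k) atTop (𝓝 0)) :
    Tendsto (timeAvg fun i => b i * sumRate S (fun k => e i k * g i k)) atTop (𝓝 0) := by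
  have hbound : ∀ M, ‖timeAvg (fun i => b i * sumRate S (fun k => e i k * g i k)) M‖
      ≤ rateConst S * ∑ k, √(v k M) := fun M => by
    have h := abs_timeAvg_sumRate_sub_le S (r := fun i k => e i k * g i k) (r' := fun _ _ => 0)
      hb (fun i k => mul_nonneg (he i k) (hg i k)) (fun _ _ => le_rfl) he hg
      (fun i k => by rw [sub_zero, abs_of_nonneg (mul_nonneg (he i k) (hg i k))]) M
    have h0 : timeAvg (fun _ => (0 : ℝ)) M = 0 := by simp [timeAvg]
    simp only [sumRate_zero, mul_zero, h0, sub_zero] at h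
    refine h.trans (mul_le_mul_of_nonneg_left ?_ (rateConst_nonneg S))
    exact Finset.sum_le_sum fun k _ => Real.sqrt_le_sqrt (hv k M)
  refine squeeze_zero_norm hbound ?_
  have hlim : Tendsto (fun M => rateConst S * ∑ k, √(v k M)) atTop
      (𝓝 (rateConst S * ∑ _k : Fin N, √0)) :=
    (tendsto_finsetSum _ fun k _ => (Real.continuous_sqrt.tendsto _).comp (hv0 k)).const_mul _
  simpa using hlim

/-- The long-run frequency with which slot `j` of the window `[0, M)` is imitated. -/
def Quantizer.weight {x : ℕ → Fin N → ℝ} {τ : ℝ} {ι : Type} [Fintype ι] [DecidableEq ι]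
    (Q : Quantizer x τ ι) (M j : ℕ) : ℝ :=
  Q.f (Q.c j) / Nat.count (fun i => Q.c i = Q.c j) M

/-- A policy on a finite window that satisfies the constraints on average, for the reweighted and
quantized gains, extends to a policy over infinitely many slots with almost the same rate. -/
theorem Quantizer.exists_feasible {S : System N} {x : ℕ → Fin N → ℝ} (hx : RegularGains x) {τ : ℝ}
    (hτ : 0 < τ) {ι : Type} [Fintype ι] [DecidableEq ι] (Q : Quantizer x τ ι) {M : ℕ}
    (hM : ∀ q, Q.f q ≠ 0 → 0 < Nat.count (fun j => Q.c j = q) M) {a P : ℕ → ℝ}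
    {p : Fin N → ℕ → ℝ} (ha : ∀ j, a j = 0 ∨ a j = 1) (hP : ∀ j, 0 ≤ P j ∧ P j ≤ S.Pmax)
    (hp : ∀ n j, 0 ≤ p n j)
    (hpow : ∑ j ∈ Finset.range M, Q.weight M j * (a j * P j) ≤ S.Pavg)
    (hbal : ∀ n, ∑ j ∈ Finset.range M, Q.weight M j * ((1 - a j) * p n j)
      ≤ ∑ j ∈ Finset.range M, Q.weight M j * (S.η' * a j * P j * Q.y (Q.c j) n))
    {C : ℝ} (hC : ∀ n, ∑ j ∈ Finset.range M, Q.weight M j * ((1 - a j) * p n j) ≤ C) :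
    ∃ π : Policy N, (balanceProblem S x).Feasible π ∧ ∀ᶠ T in atTop,
      ∑ j ∈ Finset.range M, Q.weight M j *
        ((1 - a j) * sumRate S (fun k => p k j * Q.y (Q.c j) k))
        - rateConst S * (N * √((C + 1) * τ)) - √τ ≤ (balanceProblem S x).rate π T := by
  obtain ⟨σ, hσ, hlim⟩ := exists_selection Q.c Q.tendsto_freq hM
  obtain ⟨X, hX, hXM⟩ := hx.exists_timeAvg_le
  have hx0 := hx.nonneg
  have ha0 : ∀ j, 0 ≤ a j := fun j => by rcases ha j with h | h <;> norm_num [h]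
  have ha1 : ∀ j, a j ≤ 1 := fun j => by rcases ha j with h | h <;> norm_num [h]
  have hu0 : ∀ j, 0 ≤ 1 - a j := fun j => sub_nonneg.2 (ha1 j)
  have haP : ∀ j, 0 ≤ S.η' * a j * P j := fun j =>
    mul_nonneg (mul_nonneg S.η'_nonneg (ha0 j)) (hP j).1
  have haP' : ∀ j, S.η' * a j * P j ≤ S.η' * S.Pmax := fun j => by
    rw [mul_assoc]
    refine mul_le_mul_of_nonneg_left ?_ S.η'_nonneg
    exact (mul_le_of_le_one_left (hP j).1 (ha1 j)).trans (hP j).2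
  have hηP : 0 ≤ S.η' * S.Pmax := mul_nonneg S.η'_nonneg S.Pmax_nonneg
  set Cn : Fin N → ℝ := fun n => ∑ j ∈ Finset.range M, Q.weight M j * ((1 - a j) * p n j)
  set Hn : Fin N → ℝ := fun n =>
    ∑ j ∈ Finset.range M, Q.weight M j * (S.η' * a j * P j * Q.y (Q.c j) n)
  have he : ∀ n, 0 ≤ Hn n - Cn n := fun n => sub_nonneg.2 (hbal n)
  -- The energy to be dumped: the harvest that the quantized gains ignore, plus the slack of the
  -- window constraint. It is nonnegative because the quantizer rounds down.
  let z : Fin N → ℕ → ℝ := fun n i =>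
    S.η' * a (σ i) * P (σ i) * (x i n - Q.y (Q.c i) n) + (Hn n - Cn n)
  have hz0 : ∀ n i, 0 ≤ z n i := fun n i =>
    add_nonneg (mul_nonneg (haP _) (sub_nonneg.2 (Q.y_le_gain i n))) (he n)
  have hzle : ∀ n i, z n i ≤ S.η' * S.Pmax * x i n + (Hn n - Cn n) := fun n i => by
    refine add_le_add ?_ le_rfl
    exact mul_le_mul (haP' _) (by linarith [Q.y_nonneg (Q.c i) n])
      (sub_nonneg.2 (Q.y_le_gain i n)) hηP
  choose w hw0 hwsq hwlim using fun n =>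
    ((hx.tailSmall n).of_le hηP (he n) (hzle n)).exists_dump (hz0 n)
  let sq : ℕ → ℝ := fun i => if IsSquare i then 1 else 0
  have hsq0 : ∀ i, 0 ≤ sq i := fun i => by simp only [sq]; split_ifs <;> norm_num
  have hsq1 : ∀ i, sq i ≤ 1 := fun i => by simp only [sq]; split_ifs <;> norm_num
  have hpB : ∀ n, ∃ B : ℝ, 0 ≤ B ∧ ∀ i, (1 - a (σ i)) * p n (σ i) ≤ B := fun n => by
    refine ⟨∑ j ∈ Finset.range (M + 1), (1 - a j) * p n j,
      Finset.sum_nonneg fun j _ => mul_nonneg (hu0 j) (hp n j), fun i => ?_⟩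
    exact Finset.single_le_sum (f := fun j => (1 - a j) * p n j)
      (fun j _ => mul_nonneg (hu0 j) (hp n j)) (Finset.mem_range.2 (hσ i))
  have hsqp : ∀ n, Tendsto (timeAvg fun i => sq i * ((1 - a (σ i)) * p n (σ i))) atTop (𝓝 0) :=
    fun n => by
      obtain ⟨B, hB, hBi⟩ := hpB n
      exact hx.tendsto_square_of_le n (fun i => mul_nonneg (hu0 _) (hp n _)) le_rfl hB
        (fun i => by rw [zero_mul, zero_add]; exact hBi i)
  have hsqh : ∀ n, Tendsto (timeAvg fun i => sq i * (S.η' * a (σ i) * P (σ i) * x i n)) atTop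
      (𝓝 0) := fun n =>
    hx.tendsto_square_of_le n (fun i => mul_nonneg (haP _) (hx0 i n)) hηP le_rfl
      (fun i => by rw [add_zero]; exact mul_le_mul_of_nonneg_right (haP' _) (hx0 i n))
  have hsqx : ∀ n, Tendsto (timeAvg fun i => sq i * x i n) atTop (𝓝 0) := fun n =>
    hx.tendsto_square_of_le n (fun i => hx0 i n) zero_le_one le_rfl (fun i => by simp)
  -- Square slots become uplink slots that spend the surplus; all others imitate the window.
  let π : Policy N := {
    Pd := fun n i => if IsSquare i then w n i else p n (σ i)
    P0 := fun i => P (σ i)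
    a := fun i => if IsSquare i then 0 else a (σ i) }
  have hbasic : BasicConstraints S π := by
    refine ⟨?_, fun i => hP (σ i), fun i => ?_, fun n i => ?_⟩
    · have h1 : Tendsto (fun T => ((timeAvg (fun i => a (σ i) * P (σ i)) T : ℝ) : EReal)) atTop
          (𝓝 ((∑ j ∈ Finset.range M, Q.weight M j * (a j * P j) : ℝ) : EReal)) :=
        (continuous_coe_real_ereal.tendsto _).comp (hlim fun _ j => a j * P j)
      refine le_trans ?_ (h1.limsup_eq.le.trans (EReal.coe_le_coe_iff.2 hpow))
      refine limsup_le_limsup (Eventually.of_forall fun T => EReal.coe_le_coe_iff.2 ?_)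
      refine timeAvg_mono (fun i => ?_) T
      by_cases h : IsSquare i
      · simpa [π, h] using mul_nonneg (ha0 (σ i)) (hP (σ i)).1
      · simp [π, h]
    · by_cases h : IsSquare i
      · simp [π, h]
      · simpa [π, h] using ha (σ i)
    · by_cases h : IsSquare i
      · simpa [π, h] using hw0 n i
      · simpa [π, h] using hp n (σ i)
  have henergy : EnergyBalance S x π := by
    intro n
    have h1 : Tendsto (timeAvg fun i => (1 - a (σ i)) * p n (σ i)
        - S.η' * a (σ i) * P (σ i) * Q.y (Q.c i) n) atTop (𝓝 (Cn n - Hn n)) := by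
      have h := hlim fun q j => (1 - a j) * p n j - S.η' * a j * P j * Q.y q n
      simp only [mul_sub, Finset.sum_sub_distrib] at h
      simpa only [Cn, Hn, Quantizer.weight, mul_sub] using h
    -- The imbalance of `π` is the imitated one plus the slack, plus `w - z`, minus the consumption
    -- skipped in square slots, plus the harvest lost there.
    have h2 := (((h1.add (tendsto_timeAvg_const (Hn n - Cn n))).add (hwlim n)).sub (hsqp n)).add
      (hsqh n)
    have h3 : Cn n - Hn n + (Hn n - Cn n) + 0 - 0 + 0 = 0 := by ring
    rw [h3] at h2
    refine h2.congr fun T => ?_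
    rw [← timeAvg_add, ← timeAvg_add, ← timeAvg_sub, ← timeAvg_add, ← timeAvg_sub]
    congr 1
    ext i
    by_cases h : IsSquare i
    · simp only [π, z, sq, h, if_true]; ring
    · simp only [π, z, sq, h, if_false, hwsq n i h]; ring
  refine ⟨π, ⟨hbasic, henergy⟩, ?_⟩
  have hrate : ∀ T, (balanceProblem S x).rate π T
      = timeAvg (fun i => (1 - a (σ i)) * sumRate S (fun k => p k (σ i) * x i k)) T
        + timeAvg (fun i => sq i * sumRate S (fun k => w k i * x i k)) T
        - timeAvg (fun i => sq i * (1 - a (σ i)) * sumRate S (fun k => p k (σ i) * x i k)) T := by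
    intro T
    rw [balanceProblem_rate, ← timeAvg_add, ← timeAvg_sub]
    congr 1
    ext i
    by_cases h : IsSquare i
    · simp only [π, sq, h, if_true]; ring
    · simp only [π, sq, h, if_false]; ring
  have hdump : Tendsto (timeAvg fun i => sq i * sumRate S (fun k => w k i * x i k)) atTop
      (𝓝 0) := by
    refine tendsto_timeAvg_sumRate_zero S (e := fun i k => w k i) hsq0 (fun i k => hw0 k i) hx0
      (v := fun k T => (timeAvg (fun i => w k i - z k i) T
        + (S.η' * S.Pmax * X + (Hn k - Cn k))) * timeAvg (fun i => sq i * x i k) T)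
      (fun k T => ?_) (fun k => ?_)
    · refine mul_le_mul_of_nonneg_right ?_
        (timeAvg_nonneg (fun i => mul_nonneg (hsq0 i) (hx0 i k)) T)
      have h1 : timeAvg (fun i => sq i * w k i) T
          ≤ timeAvg (fun i => (w k i - z k i) + (S.η' * S.Pmax * x i k + (Hn k - Cn k))) T := by
        refine timeAvg_mono (fun i => ?_) T
        have := mul_le_of_le_one_left (hw0 k i) (hsq1 i)
        linarith [hzle k i]
      rw [timeAvg_add, timeAvg_add, timeAvg_const_mul] at h1
      have h2 := mul_le_mul_of_nonneg_left (hXM k T) hηP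
      have h3 := timeAvg_const_le (he k) T
      linarith
    · have := ((hwlim k).add_const (S.η' * S.Pmax * X + (Hn k - Cn k))).mul (hsqx k)
      simpa using this
  have hskip : Tendsto (timeAvg fun i =>
      sq i * (1 - a (σ i)) * sumRate S (fun k => p k (σ i) * x i k)) atTop (𝓝 0) := by
    refine tendsto_timeAvg_sumRate_zero S (e := fun i k => p k (σ i))
      (fun i => mul_nonneg (hsq0 i) (hu0 _)) (fun i k => hp k _) hx0
      (v := fun k T => timeAvg (fun i => sq i * ((1 - a (σ i)) * p k (σ i))) T * X)
      (fun k T => ?_) (fun k => by simpa using (hsqp k).mul_const X)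
    simp only [mul_assoc]
    refine mul_le_mul_of_nonneg_left ((timeAvg_mono (fun i => ?_) T).trans (hXM k T))
      (timeAvg_nonneg (fun i => mul_nonneg (hsq0 i) (mul_nonneg (hu0 _) (hp k _))) T)
    rw [← mul_assoc]
    exact mul_le_of_le_one_left (hx0 i k)
      (mul_le_one₀ (hsq1 i) (hu0 _) (by linarith [ha0 (σ i)]))
  have hmain : Tendsto (timeAvg fun i =>
      (1 - a (σ i)) * sumRate S (fun k => p k (σ i) * Q.y (Q.c i) k)) atTop
      (𝓝 (∑ j ∈ Finset.range M, Q.weight M j *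
        ((1 - a j) * sumRate S (fun k => p k j * Q.y (Q.c j) k)))) :=
    hlim fun q j => (1 - a j) * sumRate S (fun k => p k j * Q.y q k)
  have hpower : ∀ n, Tendsto (timeAvg fun i => (1 - a (σ i)) * p n (σ i)) atTop (𝓝 (Cn n)) :=
    fun n => hlim fun _ j => (1 - a j) * p n j
  have hsτ : 0 < √τ / 3 := by positivity
  have hpower' : ∀ᶠ T in atTop, ∀ n, timeAvg (fun i => (1 - a (σ i)) * p n (σ i)) T < C + 1 :=
    eventually_all.2 fun n => (tendsto_order.1 (hpower n)).2 _ (by linarith [hC n])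
  filter_upwards [(tendsto_order.1 hmain).1 _ (sub_lt_self _ hsτ),
    (tendsto_order.1 hdump).1 _ (neg_lt_zero.2 hsτ), (tendsto_order.1 hskip).2 _ hsτ, hpower',
    eventually_all.2 Q.error_le] with T h1 h2 h3 h4 h5
  rw [hrate]
  have h6 := abs_timeAvg_sumRate_sub_le S (b := fun i => 1 - a (σ i))
    (r := fun i k => p k (σ i) * Q.y (Q.c i) k) (r' := fun i k => p k (σ i) * x i k)
    (e := fun i k => p k (σ i)) (g := fun i k => x i k - Q.y (Q.c i) k) (fun i => hu0 _)
    (fun i k => mul_nonneg (hp k _) (Q.y_nonneg _ k)) (fun i k => mul_nonneg (hp k _) (hx0 i k))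
    (fun i k => hp k _) (fun i k => sub_nonneg.2 (Q.y_le_gain i k))
    (fun i k => by
      rw [← mul_sub, abs_mul, abs_of_nonneg (hp k _), abs_sub_comm,
        abs_of_nonneg (sub_nonneg.2 (Q.y_le_gain i k))]) T
  have h7 : rateConst S * ∑ k, √(timeAvg (fun i => (1 - a (σ i)) * p k (σ i)) T *
      timeAvg (fun i => (1 - a (σ i)) * (x i k - Q.y (Q.c i) k)) T)
      ≤ rateConst S * (N * √((C + 1) * τ)) := by
    refine mul_le_mul_of_nonneg_left ?_ (rateConst_nonneg S)
    have : ∑ _k : Fin N, √((C + 1) * τ) = N * √((C + 1) * τ) := by simp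
    rw [← this]
    refine Finset.sum_le_sum fun k _ => Real.sqrt_le_sqrt ?_
    have h8 : timeAvg (fun i => (1 - a (σ i)) * (x i k - Q.y (Q.c i) k)) T ≤ τ :=
      (timeAvg_mono (fun i => mul_le_of_le_one_left (sub_nonneg.2 (Q.y_le_gain i k))
        (by linarith [ha0 (σ i)])) T).trans (h5 k)
    exact mul_le_mul (h4 k).le h8 (timeAvg_nonneg (fun i => mul_nonneg (hu0 _)
      (sub_nonneg.2 (Q.y_le_gain i k))) T)
      ((timeAvg_nonneg (fun i => mul_nonneg (hu0 _) (hp k _)) T).trans (h4 k).le)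
  have h9 := (abs_le.1 h6).2
  linarith

/-! ### Near-uniformity of the imitation weights -/

section Weights

variable {x : ℕ → Fin N → ℝ} {τ : ℝ} {ι : Type} [Fintype ι] [DecidableEq ι]

lemma Quantizer.f_nonneg (Q : Quantizer x τ ι) (q : ι) : 0 ≤ Q.f q :=
  ge_of_tendsto' (Q.tendsto_freq q) fun M => timeAvg_nonneg (fun i => by split_ifs <;> norm_num) M

/-- For long windows the weights are nearly uniform, except on the cells of zero frequency. -/
lemma Quantizer.eventually_weight (Q : Quantizer x τ ι) {κ : ℝ} (hκ : 0 < κ) :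
    ∀ᶠ M in atTop, (∀ q, Q.f q ≠ 0 → 0 < Nat.count (fun j => Q.c j = q) M) ∧
      ∀ j, 0 ≤ Q.weight M j ∧ Q.weight M j ≤ (1 + κ) * (1 / M) ∧
        (Q.f (Q.c j) ≠ 0 → (1 - κ) * (1 / M) ≤ Q.weight M j) := by
  have hcount : ∀ q (M : ℕ), timeAvg (fun i => if Q.c i = q then 1 else 0) M
      = Nat.count (fun j => Q.c j = q) M / (M : ℝ) := fun q M => by
    rw [timeAvg, sum_ite_eq_count]; ring
  have hq : ∀ q, ∀ᶠ M : ℕ in atTop, Q.f q ≠ 0 → 0 < Nat.count (fun j => Q.c j = q) M ∧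
      |Q.f q / Nat.count (fun j => Q.c j = q) M - 1 / M| ≤ κ * (1 / M) := by
    intro q
    by_cases hf : Q.f q = 0
    · exact Eventually.of_forall fun M h => absurd hf h
    have hpos : 0 < Q.f q := lt_of_le_of_ne (Q.f_nonneg q) (Ne.symm hf)
    have h1 := (tendsto_order.1 (Q.tendsto_freq q)).1 0 hpos
    have h2 := tendsto_const_nhds (x := Q.f q).div (Q.tendsto_freq q) hf
    rw [div_self hf] at h2
    filter_upwards [h1, Metric.tendsto_nhds.1 h2 κ hκ, eventually_gt_atTop 0] with M hM1 hM2 hM3 _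
    have hM0 : (0 : ℝ) < M := by exact_mod_cast hM3
    rw [hcount] at hM1
    rw [Pi.div_apply, hcount, Real.dist_eq] at hM2
    have hc : (0 : ℝ) < Nat.count (fun j => Q.c j = q) M := by
      by_contra hle
      exact absurd hM1 (not_lt.2 (div_nonpos_of_nonpos_of_nonneg (not_lt.1 hle) hM0.le))
    refine ⟨by exact_mod_cast hc, ?_⟩
    have h3 : Q.f q / Nat.count (fun j => Q.c j = q) M - 1 / (M : ℝ)
        = (Q.f q / (Nat.count (fun j => Q.c j = q) M / (M : ℝ)) - 1) * (1 / M) := by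
      field_simp
    rw [h3, abs_mul, abs_of_pos (by positivity : (0 : ℝ) < 1 / M)]
    exact mul_le_mul_of_nonneg_right hM2.le (by positivity)
  filter_upwards [eventually_all.2 hq] with M hM
  refine ⟨fun q hf => (hM q hf).1, fun j => ⟨div_nonneg (Q.f_nonneg _) (Nat.cast_nonneg _), ?_, ?_⟩⟩
  · by_cases hf : Q.f (Q.c j) = 0
    · rw [Quantizer.weight, hf, zero_div]; positivity
    · have := (abs_le.1 (hM _ hf).2).2
      unfold Quantizer.weight
      linarith
  · intro hf
    have := (abs_le.1 (hM _ hf).2).1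
    unfold Quantizer.weight
    linarith

lemma sum_weight_mul_le {w g : ℕ → ℝ} {M : ℕ} {κ : ℝ} (hw : ∀ j, w j ≤ (1 + κ) * (1 / M))
    (hg : ∀ j, 0 ≤ g j) : ∑ j ∈ Finset.range M, w j * g j ≤ (1 + κ) * timeAvg g M := by
  rw [timeAvg_eq_sum, Finset.mul_sum]
  refine Finset.sum_le_sum fun j _ => ?_
  rw [← mul_assoc]
  exact mul_le_mul_of_nonneg_right (hw j) (hg j)

/-- The lower bound on the weights is required only where `g` is nonzero, since it fails on cells of
zero frequency, where the quantized gains vanish. -/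
lemma abs_sum_weight_mul_sub_le {w g : ℕ → ℝ} {M : ℕ} {κ : ℝ}
    (hw : ∀ j, w j ≤ (1 + κ) * (1 / M)) (hw' : ∀ j, g j ≠ 0 → (1 - κ) * (1 / M) ≤ w j) :
    |∑ j ∈ Finset.range M, w j * g j - timeAvg g M| ≤ κ * timeAvg (fun j => |g j|) M := by
  rw [timeAvg_eq_sum, timeAvg_eq_sum, ← Finset.sum_sub_distrib, Finset.mul_sum]
  refine (Finset.abs_sum_le_sum_abs _ _).trans (Finset.sum_le_sum fun j _ => ?_)
  rw [← sub_mul, abs_mul, ← mul_assoc]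
  by_cases hg : g j = 0
  · simp [hg]
  · refine mul_le_mul_of_nonneg_right (abs_le.2 ⟨?_, ?_⟩) (abs_nonneg _)
    · linarith [hw' j hg]
    · linarith [hw j]

end Weights

/-- Scaling by `B / A` restores a violated constraint and gives up exactly the violation. -/
lemma exists_scaling {A B δ : ℝ} (hB : 0 ≤ B) (hδ : 0 ≤ δ) (h : A ≤ B + δ) :
    ∃ θ : ℝ, 0 ≤ θ ∧ θ ≤ 1 ∧ θ * A ≤ B ∧ (1 - θ) * A ≤ δ := by
  rcases le_or_gt A B with hAB | hAB
  · exact ⟨1, zero_le_one, le_rfl, by linarith, by linarith⟩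
  · have hpos : 0 < A := hB.trans_lt hAB
    have h1 : B / A * A = B := div_mul_cancel₀ B hpos.ne'
    exact ⟨B / A, by positivity, (div_le_one hpos).2 hAB.le, h1.le, by rw [sub_mul, h1]; linarith⟩

/-! ### From the battery problem to the energy balance, and equality of values -/

section Converse

variable {S : System N} {x : ℕ → Fin N → ℝ} {π : Policy N}

/-- The gains are arbitrary here because the bound serves for the true gains, the quantized ones and
their difference. -/
lemma timeAvg_harvest_le (h : BasicConstraints S π) (hx : ∀ i n, 0 ≤ x i n) {X : ℝ} {n : Fin N}
    {M : ℕ} (hX : timeAvg (fun i => x i n) M ≤ X) :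
    timeAvg (fun i => S.η' * π.a i * π.P0 i * x i n) M ≤ S.η' * S.Pmax * X := by
  have hηP : 0 ≤ S.η' * S.Pmax := mul_nonneg S.η'_nonneg S.Pmax_nonneg
  refine le_trans (timeAvg_mono (g := fun i => S.η' * S.Pmax * x i n) (fun i => ?_) M) ?_
  · refine mul_le_mul_of_nonneg_right ?_ (hx i n)
    rw [mul_assoc]
    refine mul_le_mul_of_nonneg_left ?_ S.η'_nonneg
    exact (mul_le_of_le_one_left (h.peak_power i).1 (by linarith [h.one_sub_a_nonneg i])).trans
      (h.peak_power i).2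
  · rw [timeAvg_const_mul]
    exact mul_le_mul_of_nonneg_left hX hηP

lemma eventually_timeAvg_delivered_le (h : BasicConstraints S π) (hx : ∀ i n, 0 ≤ x i n) {τ : ℝ}
    (hτ : 0 < τ) : ∀ᶠ M in atTop, ∀ n, timeAvg (fun i => (1 - π.a i) * delivered S x π n i) M
      ≤ τ + timeAvg (fun i => S.η' * π.a i * π.P0 i * x i n) M := by
  refine eventually_all.2 fun n => ?_
  have h1 : Tendsto (fun M : ℕ => 1 / (M : ℝ) * (S.B₀ n / S.ε)) atTop (𝓝 (0 * (S.B₀ n / S.ε))) :=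
    tendsto_one_div_atTop_nhds_zero_nat.mul_const _
  rw [zero_mul] at h1
  filter_upwards [(tendsto_order.1 h1).2 τ hτ] with M hM
  have h2 := mul_le_mul_of_nonneg_left (sum_delivered_le h hx n M)
    (by positivity : (0 : ℝ) ≤ 1 / M)
  rw [mul_add] at h2
  simp only [timeAvg]
  linarith

lemma timeAvg_abs_sumRate_le (S : System N) {u : ℕ → ℝ} {p g : ℕ → Fin N → ℝ}
    (hu : ∀ i, 0 ≤ u i) (hu1 : ∀ i, u i ≤ 1) (hp : ∀ i k, 0 ≤ p i k) (hg : ∀ i k, 0 ≤ g i k)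
    {M : ℕ} {A X : ℝ} (hA : ∀ k, timeAvg (fun i => u i * p i k) M ≤ A)
    (hX : ∀ k, timeAvg (fun i => g i k) M ≤ X) :
    timeAvg (fun i => |u i * sumRate S (fun k => p i k * g i k)|) M
      ≤ rateConst S * (N * √(A * X)) := by
  have h := sum_abs_sumRate_sub_le S (Finset.range M) (b := fun i => 1 / (M : ℝ) * u i)
    (r := fun i k => p i k * g i k) (r' := fun _ _ => 0) (e := p) (g := g)
    (fun i _ => mul_nonneg (by positivity) (hu i)) (fun i k => mul_nonneg (hp i k) (hg i k))
    (fun _ _ => le_rfl) hp hg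
    (fun i k => by rw [sub_zero, abs_of_nonneg (mul_nonneg (hp i k) (hg i k))])
  simp only [sumRate_zero, sub_zero, mul_assoc, ← timeAvg_eq_sum] at h
  have h1 : timeAvg (fun i => |u i * sumRate S (fun k => p i k * g i k)|) M
      = timeAvg (fun i => u i * |sumRate S (fun k => p i k * g i k)|) M := by
    congr 1; ext i; rw [abs_mul, abs_of_nonneg (hu i)]
  rw [h1]
  refine h.trans (mul_le_mul_of_nonneg_left ?_ (rateConst_nonneg S))
  have : ∑ _k : Fin N, √(A * X) = N * √(A * X) := by simp
  rw [← this]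
  refine Finset.sum_le_sum fun k _ => Real.sqrt_le_sqrt ?_
  refine mul_le_mul (hA k) ((timeAvg_mono (fun i => ?_) M).trans (hX k))
    (timeAvg_nonneg (fun i => mul_nonneg (hu i) (hg i k)) M)
    ((timeAvg_nonneg (fun i => mul_nonneg (hu i) (hp i k)) M).trans (hA k))
  exact mul_le_of_le_one_left (hg i k) (hu1 i)

/-- Any rate that is eventually achieved under the battery dynamics is achieved, up to an
arbitrarily small loss, under the average energy balance. -/
theorem exists_balance_policy (hreg : RegularGains x) (h : BasicConstraints S π) :
    ∃ K : ℝ, 0 ≤ K ∧ ∀ L : ℝ, (∀ᶠ M in atTop, L ≤ (batteryProblem S x).rate π M) →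
      ∀ τ : ℝ, 0 < τ → τ ≤ 1 → ∃ π' : Policy N, (balanceProblem S x).Feasible π' ∧
        ∀ᶠ T in atTop, L - K * √τ ≤ (balanceProblem S x).rate π' T := by
  obtain ⟨X, hX, hXM⟩ := hreg.exists_timeAvg_le
  have hx := hreg.nonneg
  have hη := S.η'_nonneg
  have hηP : 0 ≤ S.η' * S.Pmax := mul_nonneg hη S.Pmax_nonneg
  have hPavg := S.Pavg_nonneg
  have hR := rateConst_nonneg S
  set E := 1 + S.η' * S.Pmax * X with hE
  have hηPX : 0 ≤ S.η' * S.Pmax * X := mul_nonneg hηP hX.le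
  have hE0 : 0 ≤ E := by linarith
  set K₃ := 2 + 2 * (S.η' * S.Pmax * X) + S.η' * S.Pmax + S.η' * (S.Pavg + 2) with hK₃
  have hK₃0 : 0 ≤ K₃ := by positivity
  -- The summands pay, in order, for quantizing, reweighting, scaling, returning to the true gains
  -- in `Quantizer.exists_feasible`, and its extra `√τ`.
  refine ⟨rateConst S * (N * √E) + rateConst S * (N * √(E * X))
    + rateConst S * (N * √(K₃ * (2 * X))) + rateConst S * (N * √(2 * E + 1)) + 1,
    by positivity, fun L hL τ hτ hτ1 => ?_⟩
  obtain ⟨ι, _, _, ⟨Q⟩⟩ := hreg.exists_quantizer hτ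
  -- Both `κ ≤ τ` and `κ * Q.Y ≤ τ` are needed: cutting the base station's power by order `κ` can
  -- cost a harvest of order `κ * Q.Y`.
  set κ := τ / (1 + Q.Y) with hκdef
  have hY := Q.Y_nonneg
  have hκ : 0 < κ := by positivity
  have hκτ : κ ≤ τ := div_le_self hτ.le (by linarith)
  have hκY : κ * Q.Y ≤ τ := by
    rw [hκdef, div_mul_eq_mul_div, div_le_iff₀ (by positivity)]
    nlinarith
  have hpow : ∀ᶠ M in atTop, timeAvg (fun i => π.a i * π.P0 i) M < S.Pavg + κ := by
    have : limsup (fun M => ((timeAvg (fun i => π.a i * π.P0 i) M : ℝ) : EReal)) atTop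
        < ((S.Pavg + κ : ℝ) : EReal) :=
      h.avg_power.trans_lt (EReal.coe_lt_coe_iff.2 (by linarith))
    exact (eventually_lt_of_limsup_lt this).mono fun M hM => EReal.coe_lt_coe_iff.1 hM
  -- One window meeting all requirements at once; beyond it the original policy plays no role.
  obtain ⟨M, ⟨hcount, hwt⟩, hLM, hpowM, hdel, herr⟩ := ((Q.eventually_weight hκ).and
    (hL.and (hpow.and ((eventually_timeAvg_delivered_le h hx hτ).and
      (eventually_all.2 Q.error_le))))).exists
  set w := Q.weight M
  set y : ℕ → Fin N → ℝ := fun j => Q.y (Q.c j)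
  set p : Fin N → ℕ → ℝ := delivered S x π
  have hw0 : ∀ j, 0 ≤ w j := fun j => (hwt j).1
  have hw1 : ∀ j, w j ≤ (1 + κ) * (1 / M) := fun j => (hwt j).2.1
  have hy0 : ∀ j n, 0 ≤ y j n := fun j n => Q.y_nonneg _ n
  have hyx : ∀ j n, y j n ≤ x j n := Q.y_le_gain
  have hw2 : ∀ j n, y j n ≠ 0 → (1 - κ) * (1 / M) ≤ w j := fun j n hne =>
    (hwt j).2.2 fun hf => hne (Q.y_eq_zero _ hf n)
  have hp0 : ∀ n j, 0 ≤ p n j := delivered_nonneg h hx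
  have hu0 := h.one_sub_a_nonneg
  have hu1 : ∀ j, 1 - π.a j ≤ 1 := fun j => by linarith [h.a_nonneg j]
  have hharv : ∀ n, timeAvg (fun i => S.η' * π.a i * π.P0 i * x i n) M ≤ S.η' * S.Pmax * X :=
    fun n => timeAvg_harvest_le h hx (hXM n M)
  have hpE : ∀ n, timeAvg (fun i => (1 - π.a i) * p n i) M ≤ E := fun n => by
    linarith [hdel n, hharv n]
  have hyX : ∀ n, timeAvg (fun i => y i n) M ≤ X := fun n =>
    (timeAvg_mono (fun i => hyx i n) M).trans (hXM n M)
  -- scaling of the downlink powers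
  set A := ∑ j ∈ Finset.range M, w j * (π.a j * π.P0 j)
  have haP0 : ∀ j, 0 ≤ π.a j * π.P0 j := fun j => mul_nonneg (h.a_nonneg j) (h.peak_power j).1
  have hA0 : 0 ≤ A := Finset.sum_nonneg fun j _ => mul_nonneg (hw0 j) (haP0 j)
  have hA : A ≤ S.Pavg + κ * (S.Pavg + 2) := by
    have h1 : A ≤ _ := sum_weight_mul_le hw1 haP0
    have h2 := mul_le_mul_of_nonneg_left hpowM.le (by linarith : 0 ≤ 1 + κ)
    nlinarith
  obtain ⟨θ₀, hθ0, hθ1, hθA, hθA'⟩ := exists_scaling hPavg (by positivity) hA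
  set H : Fin N → ℝ := fun n => ∑ j ∈ Finset.range M, w j * (S.η' * π.a j * π.P0 j * y j n)
  have hH0 : ∀ n, 0 ≤ H n := fun n =>
    Finset.sum_nonneg fun j _ => mul_nonneg (hw0 j) (h.harvest_nonneg (x := y) (hy0 j n))
  have hHA : ∀ n, H n ≤ S.η' * Q.Y * A := fun n => by
    rw [Finset.mul_sum]
    refine Finset.sum_le_sum fun j _ => ?_
    have h1 : S.η' * π.a j * π.P0 j * y j n ≤ S.η' * Q.Y * (π.a j * π.P0 j) := by
      have := mul_le_mul_of_nonneg_left (Q.y_le (Q.c j) n) (mul_nonneg hη (haP0 j))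
      linarith
    calc _ ≤ w j * (S.η' * Q.Y * (π.a j * π.P0 j)) := mul_le_mul_of_nonneg_left h1 (hw0 j)
      _ = _ := by ring
  have hHloss : ∀ n, (1 - θ₀) * H n ≤ τ * (S.η' * (S.Pavg + 2)) := fun n => by
    have h1 := mul_le_mul_of_nonneg_left (hHA n) (sub_nonneg.2 hθ1)
    have h2 := mul_le_mul_of_nonneg_left hθA' (mul_nonneg hη hY)
    have h3 := mul_le_mul_of_nonneg_right hκY (mul_nonneg hη (by linarith : 0 ≤ S.Pavg + 2))
    linarith
  -- the reweighted consumption hardly exceeds the reweighted harvest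
  set C : Fin N → ℝ := fun n => ∑ j ∈ Finset.range M, w j * ((1 - π.a j) * p n j)
  have hC0 : ∀ n, 0 ≤ C n := fun n =>
    Finset.sum_nonneg fun j _ => mul_nonneg (hw0 j) (mul_nonneg (hu0 j) (hp0 n j))
  have hCle : ∀ n, C n ≤ (1 + κ) * timeAvg (fun i => (1 - π.a i) * p n i) M := fun n =>
    sum_weight_mul_le hw1 fun j => mul_nonneg (hu0 j) (hp0 n j)
  have hCE : ∀ n, C n ≤ 2 * E := fun n => by
    have := mul_le_mul_of_nonneg_left (hpE n) (by linarith : 0 ≤ 1 + κ)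
    nlinarith [hCle n]
  have hHge : ∀ n, timeAvg (fun i => S.η' * π.a i * π.P0 i * x i n) M
      - τ * (S.η' * S.Pmax * X) - τ * (S.η' * S.Pmax) ≤ H n := fun n => by
    have h1 := (abs_le.1 (abs_sum_weight_mul_sub_le (g := fun j => S.η' * π.a j * π.P0 j * y j n)
      hw1 fun j hne => hw2 j n fun h0 => hne (by simp only [h0, mul_zero]))).1
    have h2 : timeAvg (fun j => |S.η' * π.a j * π.P0 j * y j n|) M ≤ S.η' * S.Pmax * X := by
      simp only [abs_of_nonneg (h.harvest_nonneg (x := y) (hy0 _ n))]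
      exact timeAvg_harvest_le (x := y) h hy0 (hyX n)
    have h3 : timeAvg (fun i => S.η' * π.a i * π.P0 i * (x i n - y i n)) M ≤ S.η' * S.Pmax * τ :=
      timeAvg_harvest_le (x := fun i n => x i n - y i n) h (fun i n => sub_nonneg.2 (hyx i n))
        (herr n)
    simp only [mul_sub, timeAvg_sub] at h3
    have h4 := mul_le_mul hκτ h2 (timeAvg_nonneg (fun i => abs_nonneg _) M) hτ.le
    simp only [H]
    linarith
  -- `K₃` collects the initial charge and its reweighting, the reweighting of the harvest (twice),
  -- the quantization error, and the loss from scaling the downlink.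
  have hCH : ∀ n, C n ≤ θ₀ * H n + τ * K₃ := fun n => by
    have h1 := mul_le_mul_of_nonneg_left (hdel n) (by linarith : 0 ≤ 1 + κ)
    have h2 := hCle n
    have h3 := mul_le_mul hκτ (hharv n)
      (timeAvg_nonneg (fun i => h.harvest_nonneg (hx i n)) M) hτ.le
    have h4 : κ * τ ≤ 1 * τ := mul_le_mul_of_nonneg_right (hκτ.trans hτ1) hτ.le
    have h5 := hHge n
    have h6 := hHloss n
    have h7 : (1 + κ) * timeAvg (fun i => (1 - π.a i) * p n i) M
        ≤ (1 + κ) * (τ + timeAvg (fun i => S.η' * π.a i * π.P0 i * x i n) M) := h1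
    rw [hK₃]
    linarith
  choose θ hθn0 hθn1 hθC hθC' using fun n =>
    exists_scaling (mul_nonneg hθ0 (hH0 n)) (by positivity : 0 ≤ τ * K₃) (hCH n)
  obtain ⟨π', hfeas, hrate⟩ := Q.exists_feasible (S := S) hreg hτ hcount (a := π.a)
    (P := fun j => θ₀ * π.P0 j) (p := fun n j => θ n * p n j) h.boolean
    (fun j => ⟨mul_nonneg hθ0 (h.peak_power j).1,
      (mul_le_of_le_one_left (h.peak_power j).1 hθ1).trans (h.peak_power j).2⟩)
    (fun n j => mul_nonneg (hθn0 n) (hp0 n j))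
    (by
      refine le_trans (le_of_eq ?_) hθA
      rw [Finset.mul_sum]
      exact Finset.sum_congr rfl fun j _ => by ring)
    (fun n => by
      refine le_trans (le_of_eq ?_) ((hθC n).trans (le_of_eq ?_))
      · rw [Finset.mul_sum]
        exact Finset.sum_congr rfl fun j _ => by ring
      · rw [Finset.mul_sum]
        exact Finset.sum_congr rfl fun j _ => by ring)
    (C := 2 * E)
    (fun n => by
      refine le_trans (le_of_eq ?_) ((mul_le_of_le_one_left (hC0 n) (hθn1 n)).trans (hCE n))
      rw [Finset.mul_sum]
      exact Finset.sum_congr rfl fun j _ => by ring)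
  refine ⟨π', hfeas, hrate.mono fun T hT => le_trans ?_ hT⟩
  -- comparison of the rates
  have hsum : ∀ v : Fin N → ℝ, ∀ B, (∀ k, v k ≤ B) →
      rateConst S * ∑ k, √(v k) ≤ rateConst S * (N * √B) := fun v B hv => by
    refine mul_le_mul_of_nonneg_left ?_ hR
    have : ∑ _k : Fin N, √B = N * √B := by simp
    rw [← this]
    exact Finset.sum_le_sum fun k _ => Real.sqrt_le_sqrt (hv k)
  rw [batteryProblem_rate] at hLM
  have hquant := (abs_timeAvg_sumRate_sub_le S (b := fun i => 1 - π.a i)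
    (r := fun i k => p k i * x i k) (r' := fun i k => p k i * y i k)
    (e := fun i k => p k i) (g := fun i k => x i k - y i k) hu0
    (fun i k => mul_nonneg (hp0 k i) (hx i k)) (fun i k => mul_nonneg (hp0 k i) (hy0 i k))
    (fun i k => hp0 k i) (fun i k => sub_nonneg.2 (hyx i k))
    (fun i k => by
      rw [← mul_sub, abs_of_nonneg (mul_nonneg (hp0 k i) (sub_nonneg.2 (hyx i k)))]) M).trans
    (hsum _ (E * τ) fun k => mul_le_mul (hpE k)
      ((timeAvg_mono (fun i => mul_le_of_le_one_left (sub_nonneg.2 (hyx i k)) (hu1 i)) M).trans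
        (herr k))
      (timeAvg_nonneg (fun i => mul_nonneg (hu0 i) (sub_nonneg.2 (hyx i k))) M) hE0)
  have hrew := (abs_sum_weight_mul_sub_le
    (g := fun j => (1 - π.a j) * sumRate S (fun k => p k j * y j k)) hw1
    (fun j hne => by
      by_contra hlt
      refine hne ?_
      have : ∀ k, y j k = 0 := fun k => by
        by_contra hne'
        exact hlt (hw2 j k hne')
      simp only [this, mul_zero, sumRate_zero])).trans
    (mul_le_mul hκτ (timeAvg_abs_sumRate_le S (p := fun i k => p k i) hu0 hu1
      (fun i k => hp0 k i) hy0 hpE hyX)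
      (timeAvg_nonneg (fun i => abs_nonneg _) M) hτ.le)
  have hscale := (abs_sum_sumRate_sub_le S (Finset.range M) (b := fun j => w j * (1 - π.a j))
    (r := fun j k => p k j * y j k) (r' := fun j k => θ k * p k j * y j k)
    (e := fun j k => (1 - θ k) * p k j) (g := y) (fun j _ => mul_nonneg (hw0 j) (hu0 j))
    (fun j k => mul_nonneg (hp0 k j) (hy0 j k))
    (fun j k => mul_nonneg (mul_nonneg (hθn0 k) (hp0 k j)) (hy0 j k))
    (fun j k => mul_nonneg (sub_nonneg.2 (hθn1 k)) (hp0 k j)) hy0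
    (fun j k => by
      have h1 : p k j * y j k - θ k * p k j * y j k = (1 - θ k) * p k j * y j k := by ring
      rw [h1, abs_of_nonneg (mul_nonneg (mul_nonneg (sub_nonneg.2 (hθn1 k)) (hp0 k j))
        (hy0 j k))])).trans
    (hsum _ (K₃ * (2 * X) * τ) fun k => by
      have h1 : ∑ j ∈ Finset.range M, w j * (1 - π.a j) * ((1 - θ k) * p k j) ≤ τ * K₃ := by
        refine le_trans (le_of_eq ?_) (hθC' k)
        rw [Finset.mul_sum]
        exact Finset.sum_congr rfl fun j _ => by ring
      have h2 : ∑ j ∈ Finset.range M, w j * (1 - π.a j) * y j k ≤ 2 * X := by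
        have h3 := sum_weight_mul_le (g := fun j => (1 - π.a j) * y j k) hw1
          fun j => mul_nonneg (hu0 j) (hy0 j k)
        have h4 : timeAvg (fun j => (1 - π.a j) * y j k) M ≤ X :=
          (timeAvg_mono (fun i => mul_le_of_le_one_left (hy0 i k) (hu1 i)) M).trans (hyX k)
        have h5 := mul_le_mul_of_nonneg_left h4 (by linarith : 0 ≤ 1 + κ)
        simp only [mul_assoc]
        nlinarith
      calc _ ≤ τ * K₃ * (2 * X) := mul_le_mul h1 h2
            (Finset.sum_nonneg fun j _ => mul_nonneg (mul_nonneg (hw0 j) (hu0 j)) (hy0 j k))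
            (by positivity)
        _ = _ := by ring)
  have hsqrt : ∀ B : ℝ, 0 ≤ B → √(B * τ) = √B * √τ := fun B hB => Real.sqrt_mul hB τ
  rw [hsqrt E hE0] at hquant
  rw [hsqrt _ (by positivity)] at hscale
  rw [hsqrt _ (by positivity)]
  have hτsqrt : τ ≤ √τ := Real.le_sqrt_of_sq_le (by nlinarith)
  have hrew' : τ * (rateConst S * (N * √(E * X))) ≤ √τ * (rateConst S * (N * √(E * X))) :=
    mul_le_mul_of_nonneg_right hτsqrt (by positivity)
  have h1 := (abs_le.1 hquant).2
  have h2 := (abs_le.1 (hrew.trans hrew')).1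
  have h3 := (abs_le.1 hscale).2
  simp only [mul_assoc] at h1 h2 h3 ⊢
  linarith

/-- The spent energy is eventually bounded on average, hence so are the rates; finiteness allows
subtracting `δ` from the objective. -/
lemma exists_objective_eq_coe (hreg : RegularGains x) (h : BasicConstraints S π) :
    ∃ ℓ : ℝ, (batteryProblem S x).objective π = (ℓ : EReal) := by
  obtain ⟨X, hX, hXM⟩ := hreg.exists_timeAvg_le
  have hx := hreg.nonneg
  set B := rateConst S * (N * √((1 + S.η' * S.Pmax * X) * X))
  have hB : ∀ᶠ M in atTop, |(batteryProblem S x).rate π M| ≤ B := by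
    filter_upwards [eventually_timeAvg_delivered_le h hx one_pos] with M hM
    rw [batteryProblem_rate]
    refine (abs_timeAvg_le _ M).trans ?_
    refine timeAvg_abs_sumRate_le S (p := fun i k => delivered S x π k i) h.one_sub_a_nonneg
      (fun i => by linarith [h.a_nonneg i]) (fun i k => delivered_nonneg h hx k i) hx
      (fun k => ?_) (fun k => hXM k M)
    linarith [hM k, timeAvg_harvest_le (n := k) h hx (hXM k M)]
  have h1 : ((-B : ℝ) : EReal) ≤ (batteryProblem S x).objective π := by
    refine le_liminf_of_le ?_ ?_
    · isBoundedDefault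
    · exact hB.mono fun M hM => EReal.coe_le_coe_iff.2 (abs_le.1 hM).1
  have h2 : (batteryProblem S x).objective π ≤ ((B : ℝ) : EReal) := by
    refine liminf_le_of_frequently_le' ?_
    exact (hB.mono fun M hM => EReal.coe_le_coe_iff.2 (abs_le.1 hM).2).frequently
  exact ⟨_, (EReal.coe_toReal (ne_top_of_le_ne_top (EReal.coe_ne_top B) h2)
    (ne_bot_of_le_ne_bot (EReal.coe_ne_bot (-B)) h1)).symm⟩

theorem exists_balance_policy_objective (hreg : RegularGains x) (h : BasicConstraints S π) {δ : ℝ}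
    (hδ : 0 < δ) : ∃ π' : Policy N, (balanceProblem S x).Feasible π' ∧
      (batteryProblem S x).objective π ≤ (balanceProblem S x).objective π' + ((δ : ℝ) : EReal) := by
  obtain ⟨ℓ, hℓ⟩ := exists_objective_eq_coe hreg h
  obtain ⟨K, hK, hmain⟩ := exists_balance_policy hreg h
  have hL : ∀ᶠ M in atTop, ℓ - δ / 2 ≤ (batteryProblem S x).rate π M := by
    have h1 : ((ℓ - δ / 2 : ℝ) : EReal)
        < liminf (fun M => (((batteryProblem S x).rate π M : ℝ) : EReal)) atTop := by
      change _ < (batteryProblem S x).objective π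
      rw [hℓ]
      exact EReal.coe_lt_coe_iff.2 (by linarith)
    exact (eventually_lt_of_lt_liminf h1).mono fun M hM => (EReal.coe_lt_coe_iff.1 hM).le
  -- Accuracy `τ = s ^ 2` makes the loss `K * √τ = K * s` at most `δ / 2`.
  set s := min 1 (δ / (2 * (K + 1)))
  have hs : 0 < s := lt_min one_pos (by positivity)
  have hs1 : s ≤ 1 := min_le_left _ _
  obtain ⟨π', hfeas, hrate⟩ := hmain _ hL (s ^ 2) (by positivity) (by nlinarith)
  refine ⟨π', hfeas, ?_⟩
  have hKs : K * √(s ^ 2) ≤ δ / 2 := by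
    rw [Real.sqrt_sq hs.le]
    have h1 : s ≤ δ / (2 * (K + 1)) := min_le_right _ _
    rw [le_div_iff₀ (by positivity)] at h1
    nlinarith
  have h1 : ((ℓ - δ : ℝ) : EReal) ≤ (balanceProblem S x).objective π' := by
    refine le_liminf_of_le ?_ ?_
    · isBoundedDefault
    · exact hrate.mono fun M hM => EReal.coe_le_coe_iff.2 (by linarith)
  rw [hℓ]
  calc (ℓ : EReal) = ((ℓ - δ : ℝ) : EReal) + (δ : EReal) := by
        rw [← EReal.coe_add, sub_add_cancel]
    _ ≤ _ := add_le_add_left h1 _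

theorem value_eq (hreg : RegularGains x) :
    (batteryProblem S x).value = (balanceProblem S x).value := by
  refine le_antisymm (iSup₂_le fun π hπ => ?_) (iSup₂_le fun π hπ => ?_)
  · refine EReal.le_of_forall_lt_iff_le.1 fun c hc => ?_
    obtain ⟨d, hd1, hd2⟩ := EReal.lt_iff_exists_real_btwn.1 hc
    have hdc : d < c := EReal.coe_lt_coe_iff.1 hd2
    obtain ⟨π', hfeas, hle⟩ := exists_balance_policy_objective hreg hπ (sub_pos.2 hdc)
    have h1 : (balanceProblem S x).objective π' ≤ (balanceProblem S x).value :=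
      le_iSup₂_of_le π' hfeas le_rfl
    calc _ ≤ _ := hle
      _ ≤ (d : EReal) + ((c - d : ℝ) : EReal) := add_le_add_left (h1.trans hd1.le) _
      _ = c := by rw [← EReal.coe_add, add_sub_cancel]
  · rw [← objective_eq hreg hπ]
    exact le_iSup₂_of_le (f := fun π (_ : (batteryProblem S x).Feasible π) =>
      (batteryProblem S x).objective π) π hπ.1 le_rfl

end Converse

end EHMac

end

theorem lemma1 {N : ℕ} (S : EHMac.System N)
    {Ω : Type*} [MeasurableSpace Ω] (P : Measure Ω) [IsProbabilityMeasure P]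
    (x : ℕ → Ω → Fin N → ℝ)
    (hx_meas : ∀ i, Measurable (x i))
    (hx_nonneg : ∀ᵐ ω ∂P, ∀ i n, 0 ≤ x i ω n)
    (hx_int : ∀ n, Integrable (fun ω => x 0 ω n) P)
    (hx_stat : EHMac.IsStationaryProcess P x)
    (hx_erg : ∀ n, EHMac.IsErgodicProcess P (fun i ω => x i ω n)) :
    ∀ᵐ ω ∂P,
      -- a policy for the balance problem solves the battery problem without loss:
      -- all desired powers are delivered on average, and the average rates agree
      (∀ π : EHMac.Policy N,
        (EHMac.balanceProblem S (fun i => x i ω)).Feasible π →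
          (EHMac.batteryProblem S (fun i => x i ω)).Feasible π ∧
          (∀ n, Tendsto (fun M => EHMac.timeAvg (fun i =>
              (1 - π.a i) * (π.Pd n i - EHMac.delivered S (fun i => x i ω) π n i)) M)
            atTop (𝓝 0)) ∧
          Tendsto (fun M => (EHMac.batteryProblem S (fun i => x i ω)).rate π M
              - (EHMac.balanceProblem S (fun i => x i ω)).rate π M) atTop (𝓝 0)) ∧
      -- conversely, the battery problem cannot do better than the balance problem
      (∀ π : EHMac.Policy N,
        (EHMac.batteryProblem S (fun i => x i ω)).Feasible π →
          ∀ δ : ℝ, 0 < δ → ∃ π' : EHMac.Policy N,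
            (EHMac.balanceProblem S (fun i => x i ω)).Feasible π' ∧
            (EHMac.batteryProblem S (fun i => x i ω)).objective π
              ≤ (EHMac.balanceProblem S (fun i => x i ω)).objective π' + ((δ : ℝ) : EReal)) ∧
      -- hence the optimal values agree, and solutions of the second problem solve the first
      (EHMac.batteryProblem S (fun i => x i ω)).value
        = (EHMac.balanceProblem S (fun i => x i ω)).value ∧
      (∀ π : EHMac.Policy N,
        (EHMac.balanceProblem S (fun i => x i ω)).IsOptimal π →
          (EHMac.batteryProblem S (fun i => x i ω)).IsOptimal π) := by
  filter_upwards [EHMac.ae_regularGains P x hx_meas hx_nonneg hx_int hx_stat] with ω hreg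
  refine ⟨fun π hπ => ⟨hπ.1, fun n => EHMac.tendsto_timeAvg_shortfall hπ n,
    EHMac.tendsto_rate_sub hreg hπ⟩,
    fun π hπ δ hδ => EHMac.exists_balance_policy_objective hreg hπ hδ,
    EHMac.value_eq hreg, fun π hπ => ⟨hπ.1.1, ?_⟩⟩
  rw [EHMac.objective_eq hreg hπ.1, hπ.2, EHMac.value_eq hreg]
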